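/- All Hilbert spaces, Banach spaces and $C^*$-algebras are complex. The bidual $A^{**}$ of a $C^*$-algebra $A$ carries its usual matrix order and matrix norms, given by $M_n(A^{**})=M_n(A)^{**}$. A $C^*$-algebra $A$ (unital or not) is said to have the WEP if the canonical inclusion $i_A:A\to A^{**}$ factors as $A\to B(H)\to A^{**}$, for some Hilbert space $H$, via completely positive and completely contractive linear maps; a $C^*$-algebra is QWEP if it is a quotient of a $C^*$-algebra with the WEP. A surjective $*$-homomorphism $q:W\to M$ between $C^*$-algebras admits contractive liftings if for every separable Banach space $Y$ and every linear map $u:Y\to M$ with $\|u\|\le 1$ there is a linear map $\hat u:Y\to W$ with $\|\hat u\|\le 1$ and $q\hat u=u$. A von Neumann algebra $M$ is remotely injective if, for some Hilbert space $H$, the identity of $M$ factors as $$Id_M: M \xrightarrow{\ u\ } B(H)\xrightarrow{\ v\ } M,\qquad vu=Id_M,$$ where $u$ is linear, isometric and normal (continuous for the weak* topologies) and $v$ is linear and completely contractive ($\|v\|_{cb}\le 1$). **Proposition.** Let $M$ be a QWEP von Neumann algebra, let $W$ be a $C^*$-algebra with the WEP, and let $q:W\to M$ be a surjective $*$-homomorphism.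 If $q$ admits contractive liftings, then $M$ is remotely injective. -/

import Mathlib

open scoped CStarAlgebra ComplexOrder Topology

universe u v

namespace RemoteInj

noncomputable section

/-- A linear map `φ : A → B` between C⋆-algebras is completely contractive (`‖φ‖_cb ≤ 1`) if all
its matrix amplifications `φ_n : M_n(A) → M_n(B)` are contractive for the C⋆-norms. -/
def IsCompletelyContractive {A B : Type*}
    [NonUnitalCStarAlgebra A] [PartialOrder A] [StarOrderedRing A]
    [NonUnitalCStarAlgebra B] [PartialOrder B] [StarOrderedRing B] (φ : A →ₗ[ℂ] B) : Prop :=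
  ∀ (n : ℕ) (a : CStarMatrix (Fin n) (Fin n) A), ‖a.map φ‖ ≤ ‖a‖

/-- The Banach space bidual of `A`. -/
abbrev Bidual (A : Type*) [NonUnitalCStarAlgebra A] : Type _ :=
  StrongDual ℂ (StrongDual ℂ A)

/-- The functional on `M_n(A)` given by a matrix `f` of functionals on `A`,
namely `a ↦ ∑ i, ∑ j, f i j (a i j)`. Every bounded functional on `M_n(A)` has this form. -/
def matFunctional {A : Type*} [NonUnitalCStarAlgebra A] {n : ℕ}
    (f : Matrix (Fin n) (Fin n) (StrongDual ℂ A)) (a : CStarMatrix (Fin n) (Fin n) A) : ℂ :=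
  ∑ i, ∑ j, f i j (a i j)

/-- The evaluation of a matrix `x ∈ M_n(A⋆⋆)` at a matrix `f` of functionals on `A`: it realises
the canonical identification `M_n(A⋆⋆) = M_n(A)⋆⋆`. -/
def matEval {A : Type*} [NonUnitalCStarAlgebra A] {n : ℕ}
    (x : Matrix (Fin n) (Fin n) (Bidual A)) (f : Matrix (Fin n) (Fin n) (StrongDual ℂ A)) : ℂ :=
  ∑ i, ∑ j, x i j (f i j)

/-- The matrix `x ∈ M_n(A⋆⋆) = M_n(A)⋆⋆` is positive, i.e. it is nonnegative on all positive
functionals on `M_n(A)`. -/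
def BidualMatPos {A : Type*} [NonUnitalCStarAlgebra A] [PartialOrder A] [StarOrderedRing A] {n : ℕ}
    (x : Matrix (Fin n) (Fin n) (Bidual A)) : Prop :=
  ∀ f : Matrix (Fin n) (Fin n) (StrongDual ℂ A),
    (∀ a : CStarMatrix (Fin n) (Fin n) A, 0 ≤ a → 0 ≤ matFunctional f a) → 0 ≤ matEval x f

/-- The matrix `x ∈ M_n(A⋆⋆) = M_n(A)⋆⋆` has norm at most `c`, i.e. it is bounded by `c` on the
unit ball of the dual of `M_n(A)`. -/
def BidualMatNormLE {A : Type*} [NonUnitalCStarAlgebra A] [PartialOrder A] [StarOrderedRing A]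
    {n : ℕ} (x : Matrix (Fin n) (Fin n) (Bidual A)) (c : ℝ) : Prop :=
  ∀ f : Matrix (Fin n) (Fin n) (StrongDual ℂ A),
    (∀ a : CStarMatrix (Fin n) (Fin n) A, ‖matFunctional f a‖ ≤ ‖a‖) → ‖matEval x f‖ ≤ c

/-- Complete positivity of a linear map from a C⋆-algebra `B` into the bidual of `A`. -/
def IsCPToBidual {A B : Type*}
    [NonUnitalCStarAlgebra A] [PartialOrder A] [StarOrderedRing A]
    [NonUnitalCStarAlgebra B] [PartialOrder B] [StarOrderedRing B]
    (φ : B →ₗ[ℂ] Bidual A) : Prop :=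
  ∀ (n : ℕ) (b : CStarMatrix (Fin n) (Fin n) B), 0 ≤ b →
    BidualMatPos (Matrix.of fun i j => φ (b i j))

/-- Complete contractivity of a linear map from a C⋆-algebra `B` into the bidual of `A`. -/
def IsCCToBidual {A B : Type*}
    [NonUnitalCStarAlgebra A] [PartialOrder A] [StarOrderedRing A]
    [NonUnitalCStarAlgebra B] [PartialOrder B] [StarOrderedRing B]
    (φ : B →ₗ[ℂ] Bidual A) : Prop :=
  ∀ (n : ℕ) (b : CStarMatrix (Fin n) (Fin n) B),
    BidualMatNormLE (Matrix.of fun i j => φ (b i j)) ‖b‖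

/-- A C⋆-algebra `A` has the weak expectation property (WEP) if the canonical inclusion
`A → A⋆⋆` factors through some `B(H)` via completely positive and completely contractive maps. -/
def IsWEP (A : Type v) [NonUnitalCStarAlgebra A] [PartialOrder A] [StarOrderedRing A] : Prop :=
  ∃ (H : Type v) (_ : NormedAddCommGroup H) (_ : InnerProductSpace ℂ H) (_ : CompleteSpace H)
    (w : A →CP (H →L[ℂ] H)) (v : (H →L[ℂ] H) →ₗ[ℂ] Bidual A),
    IsCompletelyContractive w.toLinearMap ∧ IsCPToBidual v ∧ IsCCToBidual v ∧
      ∀ a : A, v (w a) = NormedSpace.inclusionInDoubleDual ℂ A a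

/-- A von Neumann algebra is norm closed; hence it is a C⋆-algebra. -/
instance isClosed_vonNeumannAlgebra {K : Type*} [NormedAddCommGroup K] [InnerProductSpace ℂ K]
    [CompleteSpace K] (M : VonNeumannAlgebra K) :
    IsClosed (M.toStarSubalgebra : Set (K →L[ℂ] K)) := by
  rw [VonNeumannAlgebra.coe_toStarSubalgebra, ← M.centralizer_centralizer]
  exact Set.isClosed_centralizer _

/-- A C⋆-algebra is QWEP if it is a quotient of a C⋆-algebra with the WEP, i.e. the range of a
surjective `⋆`-homomorphism defined on such an algebra. -/
def IsQWEP (A : Type u) [NonUnitalCStarAlgebra A] : Prop :=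
  ∃ (W : Type v) (_ : NonUnitalCStarAlgebra W) (_ : PartialOrder W) (_ : StarOrderedRing W)
    (q : W →⋆ₙₐ[ℂ] A), IsWEP W ∧ Function.Surjective q

/-- The ultraweak (σ-weak) topology on `B(H)`, i.e. its weak⋆ topology: the coarsest topology for
which all functionals `T ↦ ∑ n, ⟪ξ n, T (η n)⟫`, with `ξ, η ∈ ℓ²(ℕ, H)`, are continuous. -/
abbrev ultraweakTopology (H : Type*) [NormedAddCommGroup H] [InnerProductSpace ℂ H] [CompleteSpace H] :
    TopologicalSpace (H →L[ℂ] H) :=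
  ⨅ (ξ : lp (fun _ : ℕ => H) 2) (η : lp (fun _ : ℕ => H) 2),
    TopologicalSpace.induced (fun T : H →L[ℂ] H => ∑' n, inner ℂ (ξ n) (T (η n))) inferInstance

/-- A map from a von Neumann algebra `M ⊆ B(K)` to `B(H)` is normal if it is continuous for the
weak⋆ (ultraweak) topologies. -/
def IsNormalMap {K H : Type*}
    [NormedAddCommGroup K] [InnerProductSpace ℂ K] [CompleteSpace K]
    [NormedAddCommGroup H] [InnerProductSpace ℂ H] [CompleteSpace H]
    (M : VonNeumannAlgebra K) (u : M.toStarSubalgebra → (H →L[ℂ] H)) : Prop :=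
  Continuous[TopologicalSpace.induced (Subtype.val : M.toStarSubalgebra → (K →L[ℂ] K))
    (ultraweakTopology K), ultraweakTopology H] u

/-- A von Neumann algebra `M ⊆ B(K)` is remotely injective if, for some Hilbert space `H`, the
identity of `M` factors as `M → B(H) → M` with a normal isometric first map `u` and a completely
contractive second map `v` (the matrix norms of `M` being those of `B(K)`). -/
def IsRemotelyInjective {K : Type u}
    [NormedAddCommGroup K] [InnerProductSpace ℂ K] [CompleteSpace K]
    (M : VonNeumannAlgebra K) : Prop :=
  ∃ (H : Type u) (_ : NormedAddCommGroup H) (_ : InnerProductSpace ℂ H) (_ : CompleteSpace H)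
    (u : M.toStarSubalgebra →ₗᵢ[ℂ] (H →L[ℂ] H)) (v : (H →L[ℂ] H) →ₗ[ℂ] M.toStarSubalgebra),
    IsNormalMap M u ∧
    IsCompletelyContractive (M.toStarSubalgebra.subtype.toAlgHom.toLinearMap ∘ₗ v) ∧
    ∀ x, v (u x) = x

/-- A `⋆`-homomorphism `q : W → M` of C⋆-algebras admits contractive liftings if every contractive
linear map `u` from a separable Banach space `Y` to `M` is of the form `u = q ∘ û` for a
contractive linear map `û : Y → W`. -/
def AdmitsContractiveLiftings {W : Type v} {A : Type u}
    [NonUnitalCStarAlgebra W] [NonUnitalCStarAlgebra A] (q : W →⋆ₙₐ[ℂ] A) : Prop :=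
  ∀ (Y : Type u) [NormedAddCommGroup Y] [NormedSpace ℂ Y] [CompleteSpace Y]
    [TopologicalSpace.SeparableSpace Y] (u : Y →L[ℂ] A), ‖u‖ ≤ 1 →
      ∃ û : Y →L[ℂ] W, ‖û‖ ≤ 1 ∧ ∀ y, q (û y) = u y

end

end RemoteInj

/-!
The identity of `M` is factored by combining the weak expectation property with a countability
argument and two applications of local reflexivity.

Composing `q` with a weak expectation gives maps `w : W → B(H)` and `T : B(H) → M`, the first
contractive and the second completely contractive, with `T ∘ w = q`
(`IsWEP.exists_factorization`). A contractive lifting of a separable subspace `Y ⊆ M` then yields a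
contraction `s : Y → B(H)` with `T ∘ s` the inclusion. Neither `T` nor `s` is normal, and `s` depends
on `Y`.

The factorization of `M` is glued from local ones (`IsWeaklyClosedRep.exists_local_factorization`).
For finitely many normal functionals `f`, elements `x`, and matrix coefficients (testing complete
contractivity), it suffices to find a normal contraction `α : M → M_N` and a map `β` from the normal
functionals on `M` to the functionals on `M_N` satisfying the corresponding finitely many matricial
constraints, with `β(f)(α(x))` close to `f(x)`.

* `β` comes from `f ↦ f ∘ T` by local reflexivity (`IsWeaklyClosedRep.exists_vecSpan_approx`), in a
  form which asks only for finitely many matricial constraints at a time. This makes it a consequence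
  of Helly's theorem (`exists_of_forall_relation`), that is of the Hahn–Banach theorem, together
  with the fact that `M_n(B(H))` is the dual of the normal functionals on it. A compression to a
  finite dimensional subspace of `H` replaces `B(H)` by `M_N`.
* The compression of `s` is a map `α : Y → M_N`. It is essential here that `Y` may be any separable
  subspace (`exists_uniform_hasSection`): up to small errors there are only countably many pairs
  `(N, β)`, so if each failed on some separable subspace, then they would all fail on the separable
  subspace generated by these. Hence a single `β` works for all `Y`, and a limit along the finite
  dimensional subspaces gives a contraction `α : M → M_N` (`exists_global_section`). A second
  application of local reflexivity makes `α` normal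
  (`IsWeaklyClosedRep.exists_isVecNormal_contraction`).

The direct sum of the maps `α` is the normal map `u` into the bounded operators on a Hilbert sum, and
the limit along an ultrafilter of the maps `β`, precomposed with compressions to the summands,
defines `v` (`IsWeaklyClosedRep.exists_limit_map`). The ultraweak continuity of `u` rests on the
representation of norm limits of finite sums of vector functionals by pairs of square summable
sequences (`IsWeaklyClosedRep.exists_lp`).
-/

namespace RemoteInj

noncomputable section

/-! ### Helly's theorem for finitely many norm constraints -/

/-- On a finite product with the sup norm, the norms of the components of a functional add up to
at most its norm. -/
lemma sum_norm_comp_single_le {ι : Type*} [Fintype ι] [DecidableEq ι] {E : ι → Type*}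
    [∀ i, NormedAddCommGroup (E i)] [∀ i, NormedSpace ℂ (E i)] (Ψ : StrongDual ℂ (∀ i, E i))
    {C : ℝ} (hC : ‖Ψ‖ ≤ C) :
    ∑ i, ‖Ψ ∘L ContinuousLinearMap.single ℂ E i‖ ≤ C := by
  have key : ∀ δ > 0, ∀ i, ∃ e : E i, ‖e‖ ≤ 1 ∧
      ‖Ψ ∘L ContinuousLinearMap.single ℂ E i‖ - δ ≤ (Ψ (Pi.single i e)).re := by
    intro δ hδ i
    obtain ⟨e, he, hne⟩ := ContinuousLinearMap.exists_lt_apply_of_lt_opNorm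
      (Ψ ∘L ContinuousLinearMap.single ℂ E i) (sub_lt_self _ hδ)
    set z : ℂ := Ψ (Pi.single i e) with hz
    have hne' : ‖Ψ ∘L ContinuousLinearMap.single ℂ E i‖ - δ < ‖z‖ := by simpa [hz] using hne
    obtain ⟨c, hc, hcz⟩ := RCLike.exists_norm_eq_mul_self z
    refine ⟨c • e, ?_, ?_⟩
    · rw [norm_smul, hc, one_mul]; exact he.le
    · have : Ψ (Pi.single i (c • e)) = (‖z‖ : ℂ) := by
        rw [Pi.single_smul, map_smul, ← hz, smul_eq_mul, ← hcz]; rfl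
      rw [this]; simpa using hne'.le
  refine le_of_forall_pos_le_add fun ε hε => ?_
  obtain ⟨δ, hδ, hδε⟩ : ∃ δ > 0, Fintype.card ι * δ ≤ ε :=
    ⟨ε / (Fintype.card ι + 1), by positivity, by
      rw [mul_div_assoc', div_le_iff₀ (by positivity)]; nlinarith⟩
  choose e he hΨ using key δ hδ
  have h1 : ∑ i, (‖Ψ ∘L ContinuousLinearMap.single ℂ E i‖ - δ) ≤ C := by
    calc _ ≤ ∑ i, (Ψ (Pi.single i (e i))).re := Finset.sum_le_sum fun i _ => hΨ i
      _ = (Ψ e).re := by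
        rw [← Complex.re_sum, ← map_sum, Finset.univ_sum_single]
      _ ≤ ‖Ψ e‖ := Complex.re_le_norm _
      _ ≤ ‖Ψ‖ * ‖e‖ := Ψ.le_opNorm e
      _ ≤ ‖Ψ‖ * 1 := by
        gcongr
        exact (pi_norm_le_iff_of_nonneg zero_le_one).2 he
      _ ≤ C := by simpa using hC
  rw [Finset.sum_sub_distrib] at h1
  simp only [Finset.sum_const, Finset.card_univ, nsmul_eq_mul] at h1
  linarith

/-- A functional dominated by the maximum of finitely many seminorms `‖A i φ‖` is a sum of
functionals of the `A i φ`, with control of the norms. -/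
lemma exists_dual_decomposition {ι U : Type*} [Fintype ι] [DecidableEq ι] [AddCommMonoid U]
    [Module ℂ U] {E : ι → Type*} [∀ i, NormedAddCommGroup (E i)] [∀ i, NormedSpace ℂ (E i)]
    (A : ∀ i, U →ₗ[ℂ] E i) (x : U →ₗ[ℂ] ℂ) {s : ℝ} (hs : 0 ≤ s)
    (hx : ∀ φ, (∀ i, ‖A i φ‖ ≤ 1) → ‖x φ‖ ≤ s) :
    ∃ Ψ : ∀ i, StrongDual ℂ (E i), (∀ φ, x φ = ∑ i, Ψ i (A i φ)) ∧ ∑ i, ‖Ψ i‖ ≤ s := by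
  let _ : AddCommGroup U := Module.addCommMonoidToAddCommGroup ℂ
  let B : U →ₗ[ℂ] (∀ i, E i) := LinearMap.pi A
  have hB : ∀ φ, ‖x φ‖ ≤ s * ‖B φ‖ := by
    intro φ
    refine le_of_forall_pos_le_add fun ε hε => ?_
    obtain ⟨δ, hδ, hδε⟩ : ∃ δ > 0, s * δ ≤ ε :=
      ⟨ε / (s + 1), by positivity, by rw [mul_div_assoc', div_le_iff₀ (by positivity)]; nlinarith⟩
    have hr : 0 < ‖B φ‖ + δ := by positivity
    have := hx ((((‖B φ‖ + δ)⁻¹ : ℝ) : ℂ) • φ) fun i => by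
      rw [map_smul, norm_smul, Complex.norm_real, Real.norm_of_nonneg (by positivity),
        inv_mul_le_iff₀ hr]
      have : ‖A i φ‖ ≤ ‖B φ‖ := norm_le_pi_norm (B φ) i
      linarith
    rw [map_smul, norm_smul, Complex.norm_real, Real.norm_of_nonneg (by positivity),
      inv_mul_le_iff₀ hr] at this
    nlinarith
  obtain ⟨r, hr⟩ := B.rangeRestrict.exists_rightInverse_of_surjective B.range_rangeRestrict
  have hr' : ∀ z, B (r z) = z := fun z => congrArg Subtype.val (LinearMap.congr_fun hr z)
  let g : StrongDual ℂ (LinearMap.range B) := (x ∘ₗ r).mkContinuous s fun z => by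
    have := hB (r z)
    rw [hr'] at this
    exact this
  obtain ⟨Ψ, hΨ, hΨn⟩ := exists_extension_norm_eq _ g
  refine ⟨fun i => Ψ ∘L ContinuousLinearMap.single ℂ E i, fun φ => ?_, sum_norm_comp_single_le Ψ ?_⟩
  · have h1 : x φ = x (r (B.rangeRestrict φ)) := by
      have h2 := hB (φ - r (B.rangeRestrict φ))
      rw [map_sub, map_sub, hr'] at h2
      simpa [sub_eq_zero] using h2
    have h3 : Ψ (B φ) = x φ := by
      rw [h1]; exact hΨ (B.rangeRestrict φ)
    rw [← h3]
    conv_lhs => rw [← Finset.univ_sum_single (B φ), map_sum]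
    rfl
  · rw [hΨn]; exact LinearMap.mkContinuous_norm_le _ hs _

/-- **Helly's theorem**: finitely many norm constraints `‖A i φ‖ ≤ 1` and finitely many approximate
values `t k φ ≈ c k` are simultaneously solvable as soon as every linear relation between them is
compatible with the bounds. -/
lemma exists_of_forall_relation {ι κ U : Type*} [Fintype ι] [Fintype κ] [AddCommMonoid U]
    [Module ℂ U] {E : ι → Type*} [∀ i, NormedAddCommGroup (E i)] [∀ i, NormedSpace ℂ (E i)]
    (A : ∀ i, U →ₗ[ℂ] E i) (t : κ → U →ₗ[ℂ] ℂ) (c : κ → ℂ)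
    (h : ∀ (Ψ : ∀ i, StrongDual ℂ (E i)) (a : κ → ℂ),
      (∀ φ, ∑ k, a k * t k φ = ∑ i, Ψ i (A i φ)) → ‖∑ k, a k * c k‖ ≤ ∑ i, ‖Ψ i‖)
    {ε : ℝ} (hε : 0 < ε) :
    ∃ φ, (∀ i, ‖A i φ‖ ≤ 1) ∧ ∀ k, ‖t k φ - c k‖ < ε := by
  classical
  let τ : U →ₗ[ℂ] (κ → ℂ) := LinearMap.pi t
  let S : Set (κ → ℂ) := τ '' {φ | ∀ i, ‖A i φ‖ ≤ 1}
  suffices hc : c ∈ closure S by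
    obtain ⟨_, ⟨φ, hφ, rfl⟩, hd⟩ := Metric.mem_closure_iff.1 hc ε hε
    refine ⟨φ, hφ, fun k => ?_⟩
    rw [dist_eq_norm, norm_sub_rev] at hd
    exact (norm_le_pi_norm (τ φ - c) k).trans_lt hd
  by_contra hc
  have hconv : Convex ℝ S := by
    rintro _ ⟨φ, hφ, rfl⟩ _ ⟨ψ, hψ, rfl⟩ a b ha hb hab
    refine ⟨(a : ℂ) • φ + (b : ℂ) • ψ, fun i => ?_, ?_⟩
    · rw [map_add, map_smul, map_smul]
      refine (norm_add_le _ _).trans ?_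
      rw [norm_smul, norm_smul, Complex.norm_real, Complex.norm_real, Real.norm_of_nonneg ha,
        Real.norm_of_nonneg hb]
      nlinarith [hφ i, hψ i]
    · rw [map_add, map_smul, map_smul]; rfl
  obtain ⟨f, s, hfs, hsc⟩ := RCLike.geometric_hahn_banach_closed_point (𝕜 := ℂ) hconv.closure
    isClosed_closure hc
  have hs : 0 ≤ s := by
    have := hfs 0 (subset_closure ⟨0, fun i => by simp, by simp⟩)
    simpa using this.le
  obtain ⟨Ψ, hΨ, hΨs⟩ := exists_dual_decomposition A (f.toLinearMap ∘ₗ τ) hs fun φ hφ => by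
    by_contra! hlt
    set z : ℂ := f (τ φ) with hz
    have hzs : s < ‖z‖ := hlt
    -- rotating `φ` makes the value of the separating functional positive
    obtain ⟨c, hc, hcz⟩ := RCLike.exists_norm_eq_mul_self z
    have h1 := hfs (τ (c • φ)) (subset_closure ⟨_, fun i => by
      rw [map_smul, norm_smul, hc, one_mul]; exact hφ i, rfl⟩)
    rw [map_smul, map_smul, ← hz, smul_eq_mul, ← hcz] at h1
    have h3 : ‖z‖ < s := by simpa using h1
    linarith
  have hf : ∀ y : κ → ℂ, f y = ∑ k, f (Pi.single k 1) * y k := by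
    intro y
    conv_lhs => rw [← Finset.univ_sum_single y, map_sum]
    refine Finset.sum_congr rfl fun k _ => ?_
    rw [mul_comm, ← smul_eq_mul, ← map_smul, ← Pi.single_smul, smul_eq_mul, mul_one]
  have := h Ψ (fun k => f (Pi.single k 1)) fun φ => by
    rw [← hΨ φ]; exact (hf (τ φ)).symm
  rw [← hf] at this
  have h4 : s < (f c).re := hsc
  linarith [Complex.re_le_norm (f c)]

/-! ### Amplification of representations to matrices -/

section MatRep

variable {A : Type*} [NonUnitalCStarAlgebra A] {K : Type*} [NormedAddCommGroup K]
  [InnerProductSpace ℂ K]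

/-- The action of a matrix of operators on `Kⁿ`, as a bounded operator. -/
def matOp {n : ℕ} (b : Fin n → Fin n → (K →L[ℂ] K)) :
    PiLp 2 (fun _ : Fin n => K) →L[ℂ] PiLp 2 (fun _ : Fin n => K) :=
  (PiLp.continuousLinearEquiv 2 ℂ (fun _ : Fin n => K)).symm.toContinuousLinearMap ∘L
    (ContinuousLinearMap.pi fun p => ∑ q, (b p q) ∘L ContinuousLinearMap.proj q) ∘L
    (PiLp.continuousLinearEquiv 2 ℂ (fun _ : Fin n => K)).toContinuousLinearMap

@[simp]
lemma matOp_apply {n : ℕ} (b : Fin n → Fin n → (K →L[ℂ] K)) (ξ : PiLp 2 (fun _ : Fin n => K))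
    (p : Fin n) : matOp b ξ p = ∑ q, b p q (ξ q) := by
  simp [matOp]

lemma inner_matOp {n : ℕ} (b : Fin n → Fin n → (K →L[ℂ] K)) (ξ η : PiLp 2 (fun _ : Fin n => K)) :
    inner ℂ ξ (matOp b η) = ∑ p, ∑ q, inner ℂ (ξ p) (b p q (η q)) := by
  simp [PiLp.inner_apply, inner_sum]

variable [CompleteSpace K]

/-- The amplification of a representation of `A` on `K` to a representation of `M_n(A)` on `Kⁿ`. -/
def matRep (π : A →⋆ₙₐ[ℂ] (K →L[ℂ] K)) (n : ℕ) : CStarMatrix (Fin n) (Fin n) A →⋆ₙₐ[ℂ]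
    (PiLp 2 (fun _ : Fin n => K) →L[ℂ] PiLp 2 (fun _ : Fin n => K)) where
  toFun a := matOp fun p q => π (a p q)
  map_smul' c a := by ext ξ p; simp [Finset.smul_sum]
  map_zero' := by ext ξ p; simp
  map_add' a b := by ext ξ p; simp [Finset.sum_add_distrib]
  map_mul' a b := by
    ext ξ p
    simp only [matOp_apply, mul_apply_eq_comp, CStarMatrix.mul_apply, map_sum, map_mul,
      sum_apply]
    rw [Finset.sum_comm]
  map_star' a := by
    rw [ContinuousLinearMap.star_eq_adjoint, ContinuousLinearMap.eq_adjoint_iff]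
    intro ξ η
    rw [inner_matOp, ← inner_conj_symm, inner_matOp, map_sum, Finset.sum_comm]
    refine Finset.sum_congr rfl fun p _ => ?_
    rw [map_sum]
    refine Finset.sum_congr rfl fun q _ => ?_
    rw [CStarMatrix.star_apply, map_star, ContinuousLinearMap.star_eq_adjoint, inner_conj_symm,
      ContinuousLinearMap.adjoint_inner_left]

lemma matRep_apply (π : A →⋆ₙₐ[ℂ] (K →L[ℂ] K)) {n : ℕ} (a : CStarMatrix (Fin n) (Fin n) A) :
    matRep π n a = matOp fun p q => π (a p q) := rfl

variable [PartialOrder A] [StarOrderedRing A]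

lemma norm_matOp_le (π : A →⋆ₙₐ[ℂ] (K →L[ℂ] K)) {n : ℕ} (a : CStarMatrix (Fin n) (Fin n) A) :
    ‖matOp fun p q => π (a p q)‖ ≤ ‖a‖ :=
  NonUnitalStarAlgHom.norm_apply_le (matRep π n) a

lemma norm_sum_inner_le (π : A →⋆ₙₐ[ℂ] (K →L[ℂ] K)) {n : ℕ} (a : CStarMatrix (Fin n) (Fin n) A)
    (ξ η : PiLp 2 (fun _ : Fin n => K)) :
    ‖∑ p, ∑ q, inner ℂ (ξ p) (π (a p q) (η q))‖ ≤ ‖ξ‖ * ‖η‖ * ‖a‖ := by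
  rw [← inner_matOp (fun p q => π (a p q))]
  calc _ ≤ ‖ξ‖ * ‖matOp (fun p q => π (a p q)) η‖ := norm_inner_le_norm _ _
    _ ≤ ‖ξ‖ * (‖matOp (fun p q => π (a p q))‖ * ‖η‖) := by
      gcongr; exact ContinuousLinearMap.le_opNorm _ _
    _ ≤ ‖ξ‖ * (‖a‖ * ‖η‖) := by gcongr; exact norm_matOp_le π a
    _ = _ := by ring

lemma norm_eq_norm_matOp (π : A →⋆ₙₐ[ℂ] (K →L[ℂ] K)) (hπ : Function.Injective π) {n : ℕ}
    (a : CStarMatrix (Fin n) (Fin n) A) : ‖a‖ = ‖matOp fun p q => π (a p q)‖ := by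
  refine (NonUnitalStarAlgHom.norm_map (matRep π n) ?_ a).symm
  rw [injective_iff_map_eq_zero]
  intro b hb
  ext p q
  refine hπ ?_
  rw [CStarMatrix.zero_apply, map_zero]
  ext x
  have := congrArg (fun T => T (PiLp.single 2 q x) p) hb
  simpa [matRep_apply, Pi.single_apply, apply_ite] using this

/-- The norm of a matrix over a faithfully represented C⋆-algebra is bounded through its matrix
coefficients on unit vectors. -/
lemma norm_le_of_forall_inner (π : A →⋆ₙₐ[ℂ] (K →L[ℂ] K)) (hπ : Function.Injective π) {n : ℕ}
    (a : CStarMatrix (Fin n) (Fin n) A) {C : ℝ} (hC : 0 ≤ C)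
    (h : ∀ ξ η : PiLp 2 (fun _ : Fin n => K), ‖ξ‖ = 1 → ‖η‖ = 1 →
      ‖∑ p, ∑ q, inner ℂ (ξ p) (π (a p q) (η q))‖ ≤ C) : ‖a‖ ≤ C := by
  rw [norm_eq_norm_matOp π hπ]
  refine ContinuousLinearMap.opNorm_le_of_unit_norm (𝕜 := ℂ) hC fun η hη => ?_
  by_cases h0 : matOp (fun p q => π (a p q)) η = 0
  · simpa [h0] using hC
  set ζ := matOp (fun p q => π (a p q)) η with hζ
  have hn : (‖ζ‖ : ℂ) ≠ 0 := by simpa using h0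
  have := h (((‖ζ‖ : ℂ)⁻¹) • ζ) η (by
    rw [norm_smul, norm_inv, Complex.norm_real, norm_norm]
    exact inv_mul_cancel₀ (by simpa using h0)) hη
  rw [← inner_matOp (fun p q => π (a p q)), ← hζ, inner_smul_left, inner_self_eq_norm_sq_to_K] at this
  have e : (starRingEnd ℂ) ((‖ζ‖ : ℂ)⁻¹) * ((‖ζ‖ : ℂ)) ^ 2 = ‖ζ‖ := by
    rw [map_inv₀, Complex.conj_ofReal]; field_simp
  have e2 : ‖(starRingEnd ℂ) ((‖ζ‖ : ℂ)⁻¹) * ((‖ζ‖ : ℂ)) ^ 2‖ ≤ C := this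
  rw [e, Complex.norm_real, norm_norm] at e2
  exact e2

end MatRep

/-! ### Vector functionals and weakly closed representations -/

section VecFun

variable {A : Type*} [NonUnitalCStarAlgebra A] {K : Type*} [NormedAddCommGroup K]
  [InnerProductSpace ℂ K] [CompleteSpace K]

/-- The vector functional `a ↦ ⟪ξ, π(a) η⟫` of a representation. -/
def vecFun (π : A →⋆ₙₐ[ℂ] (K →L[ℂ] K)) (ξ η : K) : StrongDual ℂ A :=
  LinearMap.mkContinuous
    { toFun := fun a => inner ℂ ξ (π a η)
      map_add' := fun a b => by simp
      map_smul' := fun c a => by simp }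
    (‖ξ‖ * ‖η‖) fun a => by
      calc ‖inner ℂ ξ (π a η)‖ ≤ ‖ξ‖ * ‖π a η‖ := norm_inner_le_norm _ _
        _ ≤ ‖ξ‖ * (‖π a‖ * ‖η‖) := by gcongr; exact ContinuousLinearMap.le_opNorm _ _
        _ ≤ ‖ξ‖ * (‖a‖ * ‖η‖) := by gcongr; exact NonUnitalStarAlgHom.norm_apply_le π a
        _ = _ := by ring

@[simp]
lemma vecFun_apply (π : A →⋆ₙₐ[ℂ] (K →L[ℂ] K)) (ξ η : K) (a : A) :
    vecFun π ξ η a = inner ℂ ξ (π a η) := rfl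

lemma norm_vecFun_le (π : A →⋆ₙₐ[ℂ] (K →L[ℂ] K)) (ξ η : K) : ‖vecFun π ξ η‖ ≤ ‖ξ‖ * ‖η‖ :=
  LinearMap.mkContinuous_norm_le _ (by positivity) _

/-- The space of finite sums of vector functionals. -/
def vecSpan (π : A →⋆ₙₐ[ℂ] (K →L[ℂ] K)) : Submodule ℂ (StrongDual ℂ A) :=
  Submodule.span ℂ {f | ∃ ξ η, f = vecFun π ξ η}

lemma vecFun_mem (π : A →⋆ₙₐ[ℂ] (K →L[ℂ] K)) (ξ η : K) : vecFun π ξ η ∈ vecSpan π :=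
  Submodule.subset_span ⟨ξ, η, rfl⟩

/-- The vector functional `vecFun π ξ η` as an element of `vecSpan π`. -/
def vecFun' (π : A →⋆ₙₐ[ℂ] (K →L[ℂ] K)) (ξ η : K) : vecSpan π := ⟨_, vecFun_mem π ξ η⟩

@[simp]
lemma coe_vecFun' (π : A →⋆ₙₐ[ℂ] (K →L[ℂ] K)) (ξ η : K) :
    (vecFun' π ξ η : StrongDual ℂ A) = vecFun π ξ η := rfl

lemma vecSpan_induction {π : A →⋆ₙₐ[ℂ] (K →L[ℂ] K)} {p : vecSpan π → Prop}
    (h1 : ∀ ξ η, p (vecFun' π ξ η)) (h0 : p 0) (h2 : ∀ f g, p f → p g → p (f + g))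
    (h3 : ∀ (c : ℂ) f, p f → p (c • f)) (f : vecSpan π) : p f := by
  obtain ⟨f, hf⟩ := f
  induction hf using Submodule.span_induction with
  | mem f hf => obtain ⟨ξ, η, rfl⟩ := hf; exact h1 ξ η
  | zero => exact h0
  | add f g hf hg h h' => exact h2 ⟨f, hf⟩ ⟨g, hg⟩ h h'
  | smul c f hf h => exact h3 c ⟨f, hf⟩ h

/-- A functional on `vecSpan π` that is bounded on vector functionals is given by a bounded
operator on the Hilbert space. -/
lemma exists_operator (π : A →⋆ₙₐ[ℂ] (K →L[ℂ] K)) (Ψ : vecSpan π →ₗ[ℂ] ℂ) (C : ℝ)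
    (hΨ : ∀ ξ η, ‖Ψ (vecFun' π ξ η)‖ ≤ C * ‖ξ‖ * ‖η‖) :
    ∃ y : K →L[ℂ] K, ∀ ξ η, Ψ (vecFun' π ξ η) = inner ℂ ξ (y η) := by
  let B : K →L⋆[ℂ] K →L[ℂ] ℂ := LinearMap.mkContinuous₂
    (LinearMap.mk₂'ₛₗ (starRingEnd ℂ) (RingHom.id ℂ) (fun ξ η => Ψ (vecFun' π ξ η))
      (fun ξ ξ' η => by
        rw [← map_add]; congr 1; ext a; simp)
      (fun c ξ η => by
        rw [← map_smul]; congr 1; ext a; simp [mul_comm])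
      (fun ξ η η' => by
        rw [← map_add]; congr 1; ext a; simp)
      (fun c ξ η => by
        rw [RingHom.id_apply, ← map_smul]; congr 1; ext a; simp)) C hΨ
  refine ⟨ContinuousLinearMap.adjoint (InnerProductSpace.continuousLinearMapOfBilin B),
    fun ξ η => ?_⟩
  rw [ContinuousLinearMap.adjoint_inner_right,
    InnerProductSpace.continuousLinearMapOfBilin_apply]
  rfl

/-- A faithful representation is weakly closed if every functional on the space of finite sums of
vector functionals that is bounded on vector functionals is an evaluation: the algebra is then the
dual of the norm closure of that space. -/
structure IsWeaklyClosedRep (π : A →⋆ₙₐ[ℂ] (K →L[ℂ] K)) : Prop where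
  injective : Function.Injective π
  exists_eval : ∀ (Ψ : vecSpan π →ₗ[ℂ] ℂ) (C : ℝ),
    (∀ ξ η, ‖Ψ (vecFun' π ξ η)‖ ≤ C * ‖ξ‖ * ‖η‖) →
      ∃ y : A, ∀ f : vecSpan π, Ψ f = (f : StrongDual ℂ A) y

lemma IsWeaklyClosedRep.ext {π : A →⋆ₙₐ[ℂ] (K →L[ℂ] K)} (hπ : IsWeaklyClosedRep π) {a b : A}
    (h : ∀ f : vecSpan π, (f : StrongDual ℂ A) a = (f : StrongDual ℂ A) b) : a = b := by
  refine hπ.injective ?_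
  ext η
  refine ext_inner_left ℂ fun ξ => ?_
  exact h (vecFun' π ξ η)

lemma eval_eq_of_vecFun {π : A →⋆ₙₐ[ℂ] (K →L[ℂ] K)} (Ψ : vecSpan π →ₗ[ℂ] ℂ) (y : A)
    (h : ∀ ξ η, Ψ (vecFun' π ξ η) = inner ℂ ξ (π y η)) (f : vecSpan π) :
    Ψ f = (f : StrongDual ℂ A) y := by
  induction f using vecSpan_induction with
  | h1 ξ η => exact h ξ η
  | h0 => simp
  | h2 f g hf hg => simp [hf, hg]
  | h3 c f hf => simp [hf]

/-- The identity representation of `B(K)`. -/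
abbrev idRep (K : Type*) [NormedAddCommGroup K] [InnerProductSpace ℂ K] [CompleteSpace K] :
    (K →L[ℂ] K) →⋆ₙₐ[ℂ] (K →L[ℂ] K) := NonUnitalStarAlgHom.id ℂ (K →L[ℂ] K)

lemma isWeaklyClosedRep_idRep : IsWeaklyClosedRep (idRep K) where
  injective := fun _ _ h => h
  exists_eval Ψ C h := by
    obtain ⟨y, hy⟩ := exists_operator _ Ψ C h
    exact ⟨y, eval_eq_of_vecFun Ψ y hy⟩

/-- The identity representation of a von Neumann algebra `M ⊆ B(K)`. -/
def vnRep (M : VonNeumannAlgebra K) : M.toStarSubalgebra →⋆ₙₐ[ℂ] (K →L[ℂ] K) :=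
  (M.toStarSubalgebra.subtype : M.toStarSubalgebra →⋆ₐ[ℂ] (K →L[ℂ] K)).toNonUnitalStarAlgHom

/-- The bicommutant condition makes a von Neumann algebra weakly closed: the operator given by a
functional commutes with the commutant. -/
lemma isWeaklyClosedRep_vnRep (M : VonNeumannAlgebra K) : IsWeaklyClosedRep (vnRep M) where
  injective := Subtype.val_injective
  exists_eval Ψ C h := by
    obtain ⟨y, hy⟩ := exists_operator _ Ψ C h
    have hyM : y ∈ (M : Set (K →L[ℂ] K)) := by
      rw [← M.centralizer_centralizer]
      intro c hc
      ext η
      refine ext_inner_left ℂ fun ξ => ?_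
      change inner ℂ ξ (c (y η)) = inner ℂ ξ (y (c η))
      rw [← ContinuousLinearMap.adjoint_inner_left, ← hy, ← hy]
      congr 1
      ext x
      change inner ℂ _ ((x : K →L[ℂ] K) η) = inner ℂ _ ((x : K →L[ℂ] K) (c η))
      rw [ContinuousLinearMap.adjoint_inner_left]
      congr 1
      exact (congrArg (fun T => T η) (hc x x.2)).symm
    exact ⟨⟨y, hyM⟩, eval_eq_of_vecFun Ψ _ hy⟩

end VecFun

/-! ### Local reflexivity with finitely many matrix constraints -/

/-- Elements of `V ⊗ A` are separated by products of functionals. -/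
lemma tensor_eq_zero_of_forall {V A : Type*} [AddCommGroup V] [Module ℂ V] [AddCommGroup A]
    [Module ℂ A] (S : Set (A →ₗ[ℂ] ℂ)) (hS : ∀ a, (∀ f ∈ S, f a = 0) → a = 0)
    (τ : TensorProduct ℂ V A)
    (h : ∀ l : V →ₗ[ℂ] ℂ, ∀ f ∈ S, TensorProduct.lid ℂ ℂ (TensorProduct.map l f τ) = 0) :
    τ = 0 := by
  classical
  let b := Module.Basis.ofVectorSpace ℂ V
  refine (TensorProduct.equivFinsuppOfBasisLeft (N := A) b).injective ?_
  rw [map_zero]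
  ext i
  rw [Finsupp.zero_apply]
  refine hS _ fun f hf => ?_
  rw [← h (b.coord i) f hf]
  clear h
  induction τ using TensorProduct.induction_on with
  | zero => simp
  | tmul v a => simp
  | add x y hx hy => simp only [map_add, Finsupp.add_apply, hx, hy]

section LocalReflexivity

variable {A : Type*} [NonUnitalCStarAlgebra A] [PartialOrder A] [StarOrderedRing A]
  {K : Type*} [NormedAddCommGroup K] [InnerProductSpace ℂ K] [CompleteSpace K]

/-- The matrix entry `(p, q)` as a bounded linear map on `M_n(A)`. -/
def entryCLM (A : Type*) [NonUnitalCStarAlgebra A] [PartialOrder A] [StarOrderedRing A] {n : ℕ}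
    (p q : Fin n) : CStarMatrix (Fin n) (Fin n) A →L[ℂ] A :=
  LinearMap.mkContinuous
    { toFun := fun a => a p q
      map_add' := fun _ _ => rfl
      map_smul' := fun _ _ => rfl } 1 fun a => by
      rw [one_mul]
      exact CStarMatrix.norm_entry_le_norm (M := a)

@[simp]
lemma entryCLM_apply {n : ℕ} (p q : Fin n) (a : CStarMatrix (Fin n) (Fin n) A) :
    entryCLM A p q a = a p q := rfl

/-- The bounded functionals on `M_n(A)` represent, on matrices of finite sums of vector functionals,
matrices over `A` whose norm is no larger. -/
lemma IsWeaklyClosedRep.exists_matrix {π : A →⋆ₙₐ[ℂ] (K →L[ℂ] K)} (hπ : IsWeaklyClosedRep π)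
    {n : ℕ} (Ψ : StrongDual ℂ (StrongDual ℂ (CStarMatrix (Fin n) (Fin n) A))) :
    ∃ y : CStarMatrix (Fin n) (Fin n) A, ‖y‖ ≤ ‖Ψ‖ ∧
      ∀ p q, ∀ f : vecSpan π, Ψ ((f : StrongDual ℂ A) ∘L entryCLM A p q)
        = (f : StrongDual ℂ A) (y p q) := by
  have h1 : ∀ p q, ∃ y : A, ∀ f : vecSpan π, Ψ ((f : StrongDual ℂ A) ∘L entryCLM A p q)
      = (f : StrongDual ℂ A) y := by
    intro p q
    refine hπ.exists_eval
      { toFun := fun f => Ψ ((f : StrongDual ℂ A) ∘L entryCLM A p q)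
        map_add' := fun f g => by
          rw [← map_add]; rfl
        map_smul' := fun c f => by
          rw [RingHom.id_apply, ← map_smul]; rfl } ‖Ψ‖ fun ξ η => ?_
    refine (Ψ.le_opNorm _).trans ?_
    rw [mul_assoc]
    gcongr
    refine (ContinuousLinearMap.opNorm_comp_le _ _).trans ?_
    calc _ ≤ ‖ξ‖ * ‖η‖ * 1 := by
          gcongr
          · exact norm_vecFun_le π ξ η
          · exact LinearMap.mkContinuous_norm_le _ zero_le_one _
      _ = _ := mul_one _
  choose y hy using h1
  refine ⟨CStarMatrix.ofMatrix (Matrix.of y), ?_, hy⟩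
  refine norm_le_of_forall_inner π hπ.injective _ (norm_nonneg Ψ) fun ξ η hξ hη => ?_
  have h2 : ∑ p, ∑ q, inner ℂ (ξ p) (π (y p q) (η q)) =
      Ψ (∑ p, ∑ q, vecFun π (ξ p) (η q) ∘L entryCLM A p q) := by
    rw [map_sum]
    refine Finset.sum_congr rfl fun p _ => ?_
    rw [map_sum]
    exact Finset.sum_congr rfl fun q _ => (hy p q (vecFun' π (ξ p) (η q))).symm
  change ‖∑ p, ∑ q, inner ℂ (ξ p) (π (y p q) (η q))‖ ≤ _
  rw [h2]
  refine (Ψ.le_opNorm _).trans (mul_le_of_le_one_right (norm_nonneg _) ?_)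
  refine ContinuousLinearMap.opNorm_le_bound _ zero_le_one fun a => ?_
  have := norm_sum_inner_le π a ξ η
  rw [hξ, hη] at this
  simpa using this

/-- **Local reflexivity**: a linear map `φ` into the functionals on a weakly closed algebra that
satisfies finitely many matricial norm constraints can be approximated, on finitely many pairs,
by maps into the finite sums of vector functionals satisfying the same constraints. -/
lemma IsWeaklyClosedRep.exists_vecSpan_approx {π : A →⋆ₙₐ[ℂ] (K →L[ℂ] K)}
    (hπ : IsWeaklyClosedRep π) {ι κ V : Type*} [Fintype ι] [Fintype κ] [AddCommGroup V]
    [Module ℂ V] (φ : V →ₗ[ℂ] A →ₗ[ℂ] ℂ) (n : ι → ℕ) (v : ∀ i, Fin (n i) → Fin (n i) → V)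
    (hv : ∀ i (a : CStarMatrix (Fin (n i)) (Fin (n i)) A),
      ‖∑ p, ∑ q, φ (v i p q) (a p q)‖ ≤ ‖a‖)
    (w : κ → V) (y : κ → A) {ε : ℝ} (hε : 0 < ε) :
    ∃ ψ : V →ₗ[ℂ] vecSpan π,
      (∀ i (a : CStarMatrix (Fin (n i)) (Fin (n i)) A),
        ‖∑ p, ∑ q, (ψ (v i p q) : StrongDual ℂ A) (a p q)‖ ≤ ‖a‖) ∧
      ∀ k, ‖(ψ (w k) : StrongDual ℂ A) (y k) - φ (w k) (y k)‖ < ε := by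
  let F : ∀ i, (V →ₗ[ℂ] vecSpan π) →ₗ[ℂ]
      StrongDual ℂ (CStarMatrix (Fin (n i)) (Fin (n i)) A) := fun i =>
    { toFun := fun ψ => ∑ p, ∑ q, (ψ (v i p q) : StrongDual ℂ A) ∘L entryCLM A p q
      map_add' := fun ψ ψ' => by
        simp only [← Finset.sum_add_distrib]; rfl
      map_smul' := fun c ψ => by
        simp only [Finset.smul_sum]; rfl }
  have hF : ∀ i ψ a, F i ψ a = ∑ p, ∑ q, (ψ (v i p q) : StrongDual ℂ A) (a p q) := by
    intro i ψ a
    simp [F, sum_apply]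
  let t : κ → (V →ₗ[ℂ] vecSpan π) →ₗ[ℂ] ℂ := fun k =>
    { toFun := fun ψ => (ψ (w k) : StrongDual ℂ A) (y k)
      map_add' := fun ψ ψ' => rfl
      map_smul' := fun c ψ => rfl }
  obtain ⟨ψ, hψ, hψt⟩ := exists_of_forall_relation F t (fun k => φ (w k) (y k)) (fun Ψ a hrel => by
    choose z hz hzf using fun i => hπ.exists_matrix (Ψ i)
    have hτ : ∑ k, a k • (w k ⊗ₜ[ℂ] y k) -
        ∑ i, ∑ p, ∑ q, (v i p q ⊗ₜ[ℂ] z i p q) = (0 : TensorProduct ℂ V A) := by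
      refine tensor_eq_zero_of_forall
        {f | ∃ g : vecSpan π, f = (g : StrongDual ℂ A).toLinearMap} (fun x hx => ?_) _ ?_
      · exact hπ.ext fun f => by rw [map_zero]; exact hx _ ⟨f, rfl⟩
      · rintro l _ ⟨f, rfl⟩
        have h1 := hrel (l.smulRight f)
        have h2 : ∀ i, Ψ i (F i (l.smulRight f)) =
            ∑ p, ∑ q, l (v i p q) * (f : StrongDual ℂ A) (z i p q) := by
          intro i
          simp only [F, LinearMap.coe_mk, AddHom.coe_mk, map_sum]
          refine Finset.sum_congr rfl fun p _ => Finset.sum_congr rfl fun q _ => ?_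
          rw [← hzf i p q f, ← smul_eq_mul, ← map_smul]
          rfl
        rw [Finset.sum_congr rfl fun i _ => h2 i] at h1
        simp only [map_sub, map_sum, map_smul, TensorProduct.map_tmul, TensorProduct.lid_tmul,
          sub_eq_zero, smul_eq_mul]
        exact h1
    have h3 := congrArg (TensorProduct.lift φ) hτ
    simp only [map_sub, map_sum, map_smul, TensorProduct.lift.tmul, map_zero, sub_eq_zero,
      smul_eq_mul] at h3
    rw [h3]
    refine (norm_sum_le _ _).trans (Finset.sum_le_sum fun i _ => ?_)
    exact (hv i (z i)).trans (hz i)) hε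
  refine ⟨ψ, fun i a => ?_, hψt⟩
  rw [← hF]
  exact ((F i ψ).le_opNorm a).trans (mul_le_of_le_one_left (norm_nonneg _) (hψ i))

end LocalReflexivity

/-! ### Factorization of a quotient map through `B(H)` -/

section Factorization

/-- A linear family of functionals on finite sums of vector functionals is implemented by a linear
map into the algebra. -/
lemma IsWeaklyClosedRep.exists_linearMap {A : Type*} [NonUnitalCStarAlgebra A] {K : Type*}
    [NormedAddCommGroup K] [InnerProductSpace ℂ K] [CompleteSpace K]
    {π : A →⋆ₙₐ[ℂ] (K →L[ℂ] K)} (hπ : IsWeaklyClosedRep π) {D : Type*} [AddCommMonoid D]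
    [Module ℂ D] (Ψ : D →ₗ[ℂ] vecSpan π →ₗ[ℂ] ℂ) (C : D → ℝ)
    (hΨ : ∀ y ξ η, ‖Ψ y (vecFun' π ξ η)‖ ≤ C y * ‖ξ‖ * ‖η‖) :
    ∃ T : D →ₗ[ℂ] A, ∀ y (f : vecSpan π), (f : StrongDual ℂ A) (T y) = Ψ y f := by
  choose T hT using fun y => hπ.exists_eval (Ψ y) (C y) (hΨ y)
  refine ⟨{ toFun := T, map_add' := fun y z => hπ.ext fun f => ?_,
            map_smul' := fun c y => hπ.ext fun f => ?_ }, fun y f => (hT y f).symm⟩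
  · rw [map_add, ← hT, ← hT, ← hT, map_add, LinearMap.add_apply]
  · rw [RingHom.id_apply, map_smul, ← hT, ← hT, map_smul, LinearMap.smul_apply]

lemma norm_oneByOne_le {A : Type*} [NonUnitalCStarAlgebra A] [PartialOrder A] [StarOrderedRing A]
    (a : A) : ‖(CStarMatrix.ofMatrix (Matrix.of fun _ _ => a) :
      CStarMatrix (Fin 1) (Fin 1) A)‖ ≤ ‖a‖ := by
  let s : A →⋆ₙₐ[ℂ] CStarMatrix (Fin 1) (Fin 1) A :=
    { toFun := fun a => CStarMatrix.ofMatrix (Matrix.of fun _ _ => a)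
      map_smul' := fun c a => rfl
      map_zero' := rfl
      map_add' := fun a b => rfl
      map_mul' := fun a b => by
        ext p q
        simp [CStarMatrix.mul_apply, CStarMatrix.ofMatrix_apply]
      map_star' := fun a => by
        ext p q
        simp [CStarMatrix.star_apply, CStarMatrix.ofMatrix_apply] }
  exact NonUnitalStarAlgHom.norm_apply_le s a

lemma IsCompletelyContractive.norm_le {A B : Type*}
    [NonUnitalCStarAlgebra A] [PartialOrder A] [StarOrderedRing A]
    [NonUnitalCStarAlgebra B] [PartialOrder B] [StarOrderedRing B] {φ : A →ₗ[ℂ] B}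
    (hφ : IsCompletelyContractive φ) (a : A) : ‖φ a‖ ≤ ‖a‖ := by
  let s : CStarMatrix (Fin 1) (Fin 1) A := CStarMatrix.ofMatrix (Matrix.of fun _ _ => a)
  calc ‖φ a‖ ≤ ‖s.map φ‖ := CStarMatrix.norm_entry_le_norm (M := s.map φ) (i := 0) (j := 0)
    _ ≤ ‖s‖ := hφ 1 s
    _ ≤ ‖a‖ := norm_oneByOne_le a

/-- A `⋆`-homomorphism from a C⋆-algebra with the WEP to a von Neumann algebra factors through
some `B(H)` by a contraction followed by a complete contraction. -/
lemma IsWEP.exists_factorization {K : Type u} [NormedAddCommGroup K] [InnerProductSpace ℂ K]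
    [CompleteSpace K] (M : VonNeumannAlgebra K) {W : Type v} [NonUnitalCStarAlgebra W]
    [PartialOrder W] [StarOrderedRing W] (hW : IsWEP W) (q : W →⋆ₙₐ[ℂ] M.toStarSubalgebra) :
    ∃ (H : Type v) (_ : NormedAddCommGroup H) (_ : InnerProductSpace ℂ H) (_ : CompleteSpace H)
      (w : W →ₗ[ℂ] (H →L[ℂ] H)) (T : (H →L[ℂ] H) →ₗ[ℂ] M.toStarSubalgebra),
      (∀ a, ‖w a‖ ≤ ‖a‖) ∧
      (∀ (n : ℕ) (a : CStarMatrix (Fin n) (Fin n) (H →L[ℂ] H)) (ξ η : PiLp 2 (fun _ : Fin n => K)),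
        ‖ξ‖ ≤ 1 → ‖η‖ ≤ 1 →
          ‖∑ i, ∑ j, inner ℂ (ξ i) ((T (a i j) : K →L[ℂ] K) (η j))‖ ≤ ‖a‖) ∧
      ∀ a, T (w a) = q a := by
  obtain ⟨H, i1, i2, i3, w, v, hw, -, hv, hwv⟩ := hW
  let qL : W →L[ℂ] M.toStarSubalgebra :=
    LinearMap.mkContinuous
      { toFun := q, map_add' := map_add q, map_smul' := fun c a => map_smul q c a } 1
      fun a => by rw [one_mul]; exact NonUnitalStarAlgHom.norm_apply_le q a
  have hqL : ∀ a, qL a = q a := fun a => rfl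
  let Ψ : (H →L[ℂ] H) →ₗ[ℂ] vecSpan (vnRep M) →ₗ[ℂ] ℂ :=
    LinearMap.mk₂ ℂ (fun y f => v y ((f : StrongDual ℂ M.toStarSubalgebra) ∘L qL))
      (fun y z f => by rw [map_add]; rfl)
      (fun c y f => by rw [map_smul]; rfl)
      (fun y f g => by rw [← map_add]; rfl)
      (fun c y f => by rw [← map_smul]; rfl)
  have hΨ : ∀ y f, Ψ y f = v y ((f : StrongDual ℂ M.toStarSubalgebra) ∘L qL) := fun _ _ => rfl
  have hvec : ∀ ξ η, vecFun (vnRep M) ξ η ∘L qL = vecFun ((vnRep M).comp q) ξ η := by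
    intro ξ η; ext a; rfl
  obtain ⟨T, hT⟩ := (isWeaklyClosedRep_vnRep M).exists_linearMap Ψ (fun y => ‖v y‖)
    fun y ξ η => by
      rw [hΨ, coe_vecFun', hvec, mul_assoc]
      refine ((v y).le_opNorm _).trans ?_
      gcongr
      exact norm_vecFun_le _ ξ η
  refine ⟨H, i1, i2, i3, w.toLinearMap, T, hw.norm_le, fun n a ξ η hξ hη => ?_, fun a => ?_⟩
  · have h1 := hv n a (fun i j => vecFun ((vnRep M).comp q) (ξ i) (η j)) fun b => by
      refine (norm_sum_inner_le ((vnRep M).comp q) b ξ η).trans ?_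
      exact mul_le_of_le_one_left (norm_nonneg _) (mul_le_one₀ hξ (norm_nonneg _) hη)
    refine le_of_eq_of_le (congrArg _ ?_) h1
    refine Finset.sum_congr rfl fun i _ => Finset.sum_congr rfl fun j _ => ?_
    have := hT (a i j) (vecFun' (vnRep M) (ξ i) (η j))
    rw [hΨ, coe_vecFun', hvec] at this
    exact this
  · refine (isWeaklyClosedRep_vnRep M).ext fun f => ?_
    rw [hT, hΨ]
    change v (w a) _ = _
    rw [hwv, NormedSpace.dual_def]
    rfl

end Factorization

/-! ### Finite rank compressions -/

section Compression

lemma norm_toLp_comp_le {H L : Type*} [NormedAddCommGroup H] [InnerProductSpace ℂ H]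
    [NormedAddCommGroup L] [InnerProductSpace ℂ L] {J : L →L[ℂ] H} (hJ : ‖J‖ ≤ 1) {n : ℕ}
    (ζ : PiLp 2 (fun _ : Fin n => L)) :
    ‖(WithLp.toLp 2 fun i => J (ζ i) : PiLp 2 (fun _ : Fin n => H))‖ ≤ ‖ζ‖ := by
  rw [PiLp.norm_eq_of_L2, PiLp.norm_eq_of_L2]
  refine Real.sqrt_le_sqrt (Finset.sum_le_sum fun i _ => ?_)
  exact pow_le_pow_left₀ (norm_nonneg _) ((J.le_of_opNorm_le hJ _).trans_eq (one_mul _)) 2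

variable {H : Type*} [NormedAddCommGroup H] [InnerProductSpace ℂ H] [CompleteSpace H]

/-- The compression `y ↦ J⋆ y J` along a bounded operator `J`. -/
def compress {L : Type*} [NormedAddCommGroup L] [InnerProductSpace ℂ L] [CompleteSpace L]
    (J : L →L[ℂ] H) : (H →L[ℂ] H) →ₗ[ℂ] (L →L[ℂ] L) where
  toFun y := ContinuousLinearMap.adjoint J ∘L y ∘L J
  map_add' y z := by ext; simp
  map_smul' c y := by ext; simp

variable {L : Type*} [NormedAddCommGroup L] [InnerProductSpace ℂ L] [CompleteSpace L]

lemma inner_compress (J : L →L[ℂ] H) (y : H →L[ℂ] H) (a b : L) :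
    inner ℂ a (compress J y b) = inner ℂ (J a) (y (J b)) := by
  simp [compress, ContinuousLinearMap.adjoint_inner_right]

lemma norm_compress_le {J : L →L[ℂ] H} (hJ : ‖J‖ ≤ 1) (y : H →L[ℂ] H) : ‖compress J y‖ ≤ ‖y‖ := by
  calc ‖compress J y‖ ≤ ‖ContinuousLinearMap.adjoint J‖ * (‖y‖ * ‖J‖) :=
        (ContinuousLinearMap.opNorm_comp_le _ _).trans (by
          gcongr; exact ContinuousLinearMap.opNorm_comp_le _ _)
    _ ≤ 1 * (‖y‖ * 1) := by
        gcongr; rwa [LinearIsometryEquiv.norm_map]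
    _ = ‖y‖ := by ring

/-- Compression of all matrix entries by a contraction does not increase the norm of a matrix of
operators. -/
lemma norm_map_compress_le {J : L →L[ℂ] H} (hJ : ‖J‖ ≤ 1) {n : ℕ}
    (a : CStarMatrix (Fin n) (Fin n) (H →L[ℂ] H)) : ‖a.map (compress J)‖ ≤ ‖a‖ := by
  refine norm_le_of_forall_inner (idRep L) (fun _ _ h => h) _ (norm_nonneg a) fun ξ η hξ hη => ?_
  have h1 := norm_sum_inner_le (idRep H) a (WithLp.toLp 2 fun i => J (ξ i))
    (WithLp.toLp 2 fun i => J (η i))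
  have h2 : ∑ p, ∑ q, inner ℂ (ξ p) (idRep L (a.map (compress J) p q) (η q)) =
      ∑ p, ∑ q, inner ℂ (J (ξ p)) (idRep H (a p q) (J (η q))) :=
    Finset.sum_congr rfl fun i _ => Finset.sum_congr rfl fun j _ => inner_compress _ _ _ _
  rw [h2]
  refine h1.trans (mul_le_of_le_one_left (norm_nonneg _) (mul_le_one₀ ?_ (norm_nonneg _) ?_))
  · exact (norm_toLp_comp_le hJ ξ).trans hξ.le
  · exact (norm_toLp_comp_le hJ η).trans hη.le

/-- The matrix algebra `B(ℂᴺ)`. -/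
abbrev MatAlg (N : ℕ) := EuclideanSpace ℂ (Fin N) →L[ℂ] EuclideanSpace ℂ (Fin N)

/-- The map `y ↦ J y J⋆`; if `J` is an isometry it embeds `B(L)` in `B(H)` as a corner. -/
def corner (J : L →L[ℂ] H) : (L →L[ℂ] L) →ₗ[ℂ] (H →L[ℂ] H) :=
  compress (ContinuousLinearMap.adjoint J)

lemma norm_map_corner_le {J : L →L[ℂ] H} (hJ : ‖J‖ ≤ 1) {n : ℕ}
    (a : CStarMatrix (Fin n) (Fin n) (L →L[ℂ] L)) : ‖a.map (corner J)‖ ≤ ‖a‖ :=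
  norm_map_compress_le (by rwa [LinearIsometryEquiv.norm_map]) a

lemma adjoint_apply_self (J : L →ₗᵢ[ℂ] H) (c : L) :
    ContinuousLinearMap.adjoint J.toContinuousLinearMap (J c) = c := by
  refine ext_inner_left ℂ fun d => ?_
  rw [ContinuousLinearMap.adjoint_inner_right]
  exact J.inner_map_map d c

lemma compress_corner (J : L →ₗᵢ[ℂ] H) (y : L →L[ℂ] L) :
    compress J.toContinuousLinearMap (corner J.toContinuousLinearMap y) = y := by
  ext b
  refine ext_inner_left ℂ fun a => ?_
  rw [inner_compress, corner, inner_compress]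
  change inner ℂ (ContinuousLinearMap.adjoint J.toContinuousLinearMap (J a)) (y
    (ContinuousLinearMap.adjoint J.toContinuousLinearMap (J b))) = _
  rw [adjoint_apply_self, adjoint_apply_self]

lemma inner_corner_compress (J : L →ₗᵢ[ℂ] H) (y : H →L[ℂ] H) (a b : L) :
    inner ℂ (J a) (corner J.toContinuousLinearMap (compress J.toContinuousLinearMap y) (J b))
      = inner ℂ (J a) (y (J b)) := by
  have := inner_compress J.toContinuousLinearMap
    (corner J.toContinuousLinearMap (compress J.toContinuousLinearMap y)) a b
  rw [compress_corner, inner_compress] at this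
  exact this.symm

/-- A finite sum of vector functionals on `B(H)` only depends on the compression to some finite
dimensional subspace, and to any larger one. -/
lemma exists_finiteDimensional_support (f : vecSpan (idRep H)) :
    ∃ S : Submodule ℂ H, FiniteDimensional ℂ S ∧
      ∀ (N : ℕ) (J : EuclideanSpace ℂ (Fin N) →ₗᵢ[ℂ] H), S ≤ LinearMap.range J.toLinearMap →
        ∀ y, (f : StrongDual ℂ (H →L[ℂ] H)) (corner J.toContinuousLinearMap
          (compress J.toContinuousLinearMap y)) = (f : StrongDual ℂ (H →L[ℂ] H)) y := by
  induction f using vecSpan_induction with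
  | h1 ξ η =>
    refine ⟨Submodule.span ℂ {ξ, η}, FiniteDimensional.span_of_finite ℂ (Set.toFinite _),
      fun N J hJ y => ?_⟩
    obtain ⟨a, ha⟩ := hJ (Submodule.subset_span (Set.mem_insert ξ {η}))
    obtain ⟨b, hb⟩ := hJ (Submodule.subset_span (Set.mem_insert_of_mem ξ (Set.mem_singleton η)))
    rw [coe_vecFun', vecFun_apply, vecFun_apply, ← ha, ← hb]
    exact inner_corner_compress J y a b
  | h0 => exact ⟨⊥, inferInstance, fun N J _ y => rfl⟩
  | h2 f g hf hg =>
    obtain ⟨S, hS, hf⟩ := hf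
    obtain ⟨S', hS', hg⟩ := hg
    refine ⟨S ⊔ S', inferInstance, fun N J hJ y => ?_⟩
    have h1 := hf N J (le_sup_left.trans hJ) y
    have h2 := hg N J (le_sup_right.trans hJ) y
    rw [Submodule.coe_add, add_apply, add_apply, h1, h2]
  | h3 c f hf =>
    obtain ⟨S, hS, hf⟩ := hf
    refine ⟨S, hS, fun N J hJ y => ?_⟩
    rw [Submodule.coe_smul, smul_apply, smul_apply, hf N J hJ y]

end Compression

/-! ### Limits of families of linear maps along ultrafilters -/

/-- Pointwise limits along an ultrafilter of eventually linear, pointwise eventually bounded maps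
with values in a proper space exist and are linear. -/
lemma exists_linear_limit {I : Type*} (U : Ultrafilter I) {V G : Type*} [AddCommMonoid V]
    [Module ℂ V] [NormedAddCommGroup G] [NormedSpace ℂ G] [ProperSpace G] (g : I → V → G)
    (hadd : ∀ v w, ∀ᶠ i in U, g i (v + w) = g i v + g i w)
    (hsmul : ∀ (c : ℂ) v, ∀ᶠ i in U, g i (c • v) = c • g i v)
    (hb : ∀ v, ∃ C, ∀ᶠ i in U, ‖g i v‖ ≤ C) :
    ∃ L : V →ₗ[ℂ] G, ∀ v, Filter.Tendsto (fun i => g i v) U (𝓝 (L v)) := by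
  have h : ∀ v, ∃ l, Filter.Tendsto (fun i => g i v) U (𝓝 l) := by
    intro v
    obtain ⟨C, hC⟩ := hb v
    obtain ⟨l, -, hl⟩ := (isCompact_closedBall (0 : G) C).ultrafilter_le_nhds
      (U.map fun i => g i v) (by
        rw [Filter.le_principal_iff]
        change ∀ᶠ i in U, g i v ∈ Metric.closedBall 0 C
        filter_upwards [hC] with i hi
        simpa using hi)
    exact ⟨l, hl⟩
  choose L hL using h
  refine ⟨{ toFun := L, map_add' := fun v w => ?_, map_smul' := fun c v => ?_ }, hL⟩
  · refine tendsto_nhds_unique ((hL (v + w)).congr' ?_) ((hL v).add (hL w))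
    exact hadd v w
  · refine tendsto_nhds_unique ((hL (c • v)).congr' ?_) ((hL v).const_smul c)
    exact hsmul c v

/-! ### Approximate factorizations through matrix algebras -/

section Core

variable {K : Type u} [NormedAddCommGroup K] [InnerProductSpace ℂ K] [CompleteSpace K]

/-- The index set of the matricial constraints: pairs of vectors of some `Kⁿ`. -/
abbrev Constr (K : Type u) [NormedAddCommGroup K] [InnerProductSpace ℂ K] : Type u :=
  Σ n : ℕ, PiLp 2 (fun _ : Fin n => K) × PiLp 2 (fun _ : Fin n => K)

/-- The map `β` from normal functionals on `A` to functionals on `D` satisfies the matricial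
constraint given by `c = (n, ξ, η)`: for `ξ`, `η` in the unit ball, the functional
`a ↦ ∑ β(⟪ξ p, · (η q)⟫)(a p q)` on `M_n(D)` is contractive. -/
def SatisfiesConstr {A : Type*} [NonUnitalCStarAlgebra A] (π : A →⋆ₙₐ[ℂ] (K →L[ℂ] K))
    {D : Type*} [NonUnitalCStarAlgebra D] [PartialOrder D] [StarOrderedRing D]
    (β : vecSpan π →ₗ[ℂ] StrongDual ℂ D) (c : Constr K) : Prop :=
  ‖c.2.1‖ ≤ 1 → ‖c.2.2‖ ≤ 1 → ∀ a : CStarMatrix (Fin c.1) (Fin c.1) D,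
    ‖∑ p, ∑ q, β (vecFun' π (c.2.1 p) (c.2.2 q)) (a p q)‖ ≤ ‖a‖

/-- Local reflexivity applied to the preadjoint of a complete contraction `T : B(H) → A`, followed
by a finite rank compression: on finitely many functionals and operators, the map `f ↦ f ∘ T` is
approximated by maps into the functionals on a matrix algebra. -/
lemma exists_matAlg_approx {A : Type*} [NonUnitalCStarAlgebra A] (π : A →⋆ₙₐ[ℂ] (K →L[ℂ] K))
    {H : Type*} [NormedAddCommGroup H] [InnerProductSpace ℂ H] [CompleteSpace H]
    (T : (H →L[ℂ] H) →ₗ[ℂ] A)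
    (hT : ∀ (n : ℕ) (a : CStarMatrix (Fin n) (Fin n) (H →L[ℂ] H))
      (ξ η : PiLp 2 (fun _ : Fin n => K)), ‖ξ‖ ≤ 1 → ‖η‖ ≤ 1 →
        ‖∑ i, ∑ j, inner ℂ (ξ i) (π (T (a i j)) (η j))‖ ≤ ‖a‖)
    (Sf : Finset (vecSpan π)) (Sy : Finset (H →L[ℂ] H)) (C : Finset (Constr K))
    {ε : ℝ} (hε : 0 < ε) :
    ∃ (N : ℕ) (J : EuclideanSpace ℂ (Fin N) →ₗᵢ[ℂ] H)
      (β : vecSpan π →ₗ[ℂ] StrongDual ℂ (MatAlg N)),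
      (∀ c ∈ C, SatisfiesConstr π β c) ∧ ∀ f ∈ Sf, ∀ y ∈ Sy,
        ‖β f (compress J.toContinuousLinearMap y) - (f : StrongDual ℂ A) (T y)‖ < ε := by
  let φ : vecSpan π →ₗ[ℂ] (H →L[ℂ] H) →ₗ[ℂ] ℂ :=
    { toFun := fun f => (f : StrongDual ℂ A).toLinearMap ∘ₗ T
      map_add' := fun f g => rfl
      map_smul' := fun c f => rfl }
  have hφ : ∀ ξ η y, φ (vecFun' π ξ η) y = inner ℂ ξ (π (T y) η) := fun _ _ _ => rfl
  let ι := {c : C // ‖c.1.2.1‖ ≤ 1 ∧ ‖c.1.2.2‖ ≤ 1}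
  have : Fintype ι := Fintype.ofFinite ι
  obtain ⟨ψ, hψ, hψt⟩ := (isWeaklyClosedRep_idRep (K := H)).exists_vecSpan_approx φ
    (fun c : ι => c.1.1.1) (fun c p q => vecFun' π (c.1.1.2.1 p) (c.1.1.2.2 q))
    (fun c a => by
      simp only [hφ]
      exact hT _ a _ _ c.2.1 c.2.2)
    (fun k : Sf × Sy => (k.1 : vecSpan π)) (fun k : Sf × Sy => (k.2 : H →L[ℂ] H)) hε
  choose S hSfin hS using fun f => exists_finiteDimensional_support (ψ f)
  let R : Submodule ℂ H := Sf.sup S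
  have hR : FiniteDimensional ℂ R :=
     Submodule.finiteDimensional_finset_sup Sf S
  let J : EuclideanSpace ℂ (Fin (Module.finrank ℂ R)) →ₗᵢ[ℂ] H :=
    R.subtypeₗᵢ.comp (stdOrthonormalBasis ℂ R).repr.symm.toLinearIsometry
  have hJ : R ≤ LinearMap.range J.toLinearMap := by
    intro x hx
    exact ⟨(stdOrthonormalBasis ℂ R).repr ⟨x, hx⟩, by simp [J]⟩
  have hJn : ‖J.toContinuousLinearMap‖ ≤ 1 := J.norm_toContinuousLinearMap_le
  let cJ : MatAlg (Module.finrank ℂ R) →L[ℂ] (H →L[ℂ] H) :=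
    LinearMap.toContinuousLinearMap (corner J.toContinuousLinearMap)
  let β : vecSpan π →ₗ[ℂ] StrongDual ℂ (MatAlg (Module.finrank ℂ R)) :=
    { toFun := fun f => (ψ f : StrongDual ℂ (H →L[ℂ] H)) ∘L cJ
      map_add' := fun f g => by rw [map_add]; rfl
      map_smul' := fun c f => by rw [map_smul]; rfl }
  refine ⟨_, J, β, fun c hc h1 h2 a => ?_, fun f hf y hy => ?_⟩
  · exact (hψ ⟨⟨c, hc⟩, h1, h2⟩ (a.map (corner J.toContinuousLinearMap))).trans
      (norm_map_corner_le hJn a)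
  · have h1 : β f (compress J.toContinuousLinearMap y) = (ψ f : StrongDual ℂ (H →L[ℂ] H)) y :=
      hS f _ J ((Finset.le_sup hf).trans hJ) y
    rw [h1]
    exact hψt (⟨f, hf⟩, ⟨y, hy⟩)

/-- `β` admits a contractive right inverse on the subspace `Y`, up to `ε` on given finite sets. -/
def HasSection {A : Type*} [NonUnitalCStarAlgebra A] {π : A →⋆ₙₐ[ℂ] (K →L[ℂ] K)} {N : ℕ}
    (β : vecSpan π →ₗ[ℂ] StrongDual ℂ (MatAlg N)) (Sf : Finset (vecSpan π)) (Sx : Finset A)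
    (ε : ℝ) (Y : Submodule ℂ A) : Prop :=
  ∃ α : Y →ₗ[ℂ] MatAlg N, (∀ x, ‖α x‖ ≤ ‖x‖) ∧
    ∀ f ∈ Sf, ∀ x ∈ Sx, ∀ h : x ∈ Y, ‖β f (α ⟨x, h⟩) - (f : StrongDual ℂ A) x‖ ≤ ε

lemma HasSection.mono {A : Type*} [NonUnitalCStarAlgebra A] {π : A →⋆ₙₐ[ℂ] (K →L[ℂ] K)} {N : ℕ}
    {β : vecSpan π →ₗ[ℂ] StrongDual ℂ (MatAlg N)} {Sf : Finset (vecSpan π)} {Sx : Finset A}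
    {ε : ℝ} {Y Z : Submodule ℂ A} (h : HasSection β Sf Sx ε Z) (hYZ : Y ≤ Z) :
    HasSection β Sf Sx ε Y := by
  obtain ⟨α, hα, hαt⟩ := h
  exact ⟨α ∘ₗ Submodule.inclusion hYZ, fun x => hα _, fun f hf x hx h => hαt f hf x hx (hYZ h)⟩

/-- A family of finite tuples in a finite dimensional space is approximated by countably many of its
members. -/
lemma exists_countable_approx {X κ E : Type*} [Fintype κ] [NormedAddCommGroup E]
    [NormedSpace ℂ E] [FiniteDimensional ℂ E] (ev : X → κ → E) :
    ∃ D : Set X, D.Countable ∧ ∀ x, ∀ δ > 0, ∃ d ∈ D, ∀ k, ‖ev x k - ev d k‖ < δ := by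
  have : ProperSpace E := FiniteDimensional.proper_rclike ℂ E
  have : SecondCountableTopology (κ → E) := inferInstance
  obtain ⟨D, hD, hDd⟩ := TopologicalSpace.exists_countable_dense (Set.range ev)
  choose pre hpre using fun e : Set.range ev => e.2
  refine ⟨pre '' D, hD.image _, fun x δ hδ => ?_⟩
  obtain ⟨e, he, hde⟩ := Metric.dense_iff.1 hDd ⟨ev x, Set.mem_range_self _⟩ δ hδ
  refine ⟨pre e, ⟨e, hde, rfl⟩, fun k => ?_⟩
  have h1 : dist (ev x) (ev (pre e)) < δ := by
    rw [hpre, dist_comm]; exact he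
  rw [dist_eq_norm] at h1
  exact (norm_le_pi_norm (ev x - ev (pre e)) k).trans_lt h1

/-- If every separable closed subspace admits a section, for some `β` subject to given constraints
and depending on the subspace, then one `β` works for all separable subspaces: up to small errors
only countably many `β` matter, and a counterexample to each of them would generate together a
separable subspace. -/
lemma exists_uniform_hasSection {A : Type*} [NonUnitalCStarAlgebra A]
    (π : A →⋆ₙₐ[ℂ] (K →L[ℂ] K)) (Sf : Finset (vecSpan π)) (Sx : Finset A) {ε : ℝ} (hε : 0 < ε)
    (P : ∀ N, (vecSpan π →ₗ[ℂ] StrongDual ℂ (MatAlg N)) → Prop)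
    (h : ∀ Y : Submodule ℂ A, IsClosed (Y : Set A) → TopologicalSpace.IsSeparable (Y : Set A) →
      ∃ N β, P N β ∧ HasSection β Sf Sx (ε / 2) Y) :
    ∃ N β, P N β ∧ ∀ Y : Submodule ℂ A, TopologicalSpace.IsSeparable (Y : Set A) →
      HasSection β Sf Sx ε Y := by
  by_contra! hcon
  -- countably many `β` are dense among the admissible ones, as far as values on `Sf` matter
  have hD : ∀ N, ∃ D : Set {β : vecSpan π →ₗ[ℂ] StrongDual ℂ (MatAlg N) // P N β}, D.Countable ∧
      ∀ β : {β : vecSpan π →ₗ[ℂ] StrongDual ℂ (MatAlg N) // P N β}, ∀ δ > 0, ∃ d ∈ D, ∀ f : Sf,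
        ‖β.1 f - d.1 f‖ < δ := fun N =>
    exists_countable_approx fun (β : {β : vecSpan π →ₗ[ℂ] StrongDual ℂ (MatAlg N) // P N β})
      (f : Sf) => β.1 f
  choose D hDc hDd using hD
  choose Z hZs hZ using fun (N : ℕ)
    (β : {β : vecSpan π →ₗ[ℂ] StrongDual ℂ (MatAlg N) // P N β}) => hcon N β.1 β.2
  let S : Set A := ⋃ N, ⋃ β ∈ D N, (Z N β : Set A)
  have hS : TopologicalSpace.IsSeparable S := by
    refine .iUnion fun N => ?_
    have := (hDc N).to_subtype
    rw [Set.biUnion_eq_iUnion]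
    exact .iUnion fun β => hZs N β
  let Y : Submodule ℂ A := (Submodule.span ℂ S).topologicalClosure
  obtain ⟨N, β, hβ, α, hα, hαt⟩ := h Y (Submodule.isClosed_topologicalClosure _)
    (hS.span (R := ℂ)).closure
  obtain ⟨δ, hδ, hδε⟩ : ∃ δ > 0, δ * ∑ x ∈ Sx, ‖x‖ ≤ ε / 2 := by
    have h0 : 0 ≤ ∑ x ∈ Sx, ‖x‖ := Finset.sum_nonneg fun _ _ => norm_nonneg _
    refine ⟨ε / 2 / (∑ x ∈ Sx, ‖x‖ + 1), by positivity, ?_⟩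
    rw [div_mul_eq_mul_div, div_le_iff₀ (by positivity)]
    nlinarith
  obtain ⟨d, hd, hdβ⟩ := hDd N ⟨β, hβ⟩ δ hδ
  refine hZ N d (HasSection.mono (Z := Y) ⟨α, hα, fun f hf x hx hxY => ?_⟩ ?_)
  · have h1 : ‖(d.1 f - β f) (α ⟨x, hxY⟩)‖ ≤ ε / 2 := by
      refine (ContinuousLinearMap.le_opNorm _ _).trans (le_trans ?_ hδε)
      have h2 : ‖α ⟨x, hxY⟩‖ ≤ ∑ x ∈ Sx, ‖x‖ :=
        (hα _).trans (Finset.single_le_sum (f := fun x => ‖x‖) (fun _ _ => norm_nonneg _) hx)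
      rw [norm_sub_rev]
      gcongr
      exact (hdβ ⟨f, hf⟩).le
    have h2 := hαt f hf x hx hxY
    calc _ = ‖(d.1 f - β f) (α ⟨x, hxY⟩) +
          (β f (α ⟨x, hxY⟩) - (f : StrongDual ℂ A) x)‖ := by
          rw [sub_apply]; congr 1; ring
      _ ≤ ε / 2 + ε / 2 := (norm_add_le _ _).trans (add_le_add h1 h2)
      _ = ε := by ring
  · refine le_trans (fun x hx => ?_) (Submodule.le_topologicalClosure _)
    exact Submodule.subset_span (Set.mem_iUnion.2 ⟨N, Set.mem_iUnion₂.2 ⟨d, hd, hx⟩⟩)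

/-- Sections on all finite dimensional subspaces have a limit defined on the whole algebra. -/
lemma exists_global_section {A : Type*} [NonUnitalCStarAlgebra A]
    {π : A →⋆ₙₐ[ℂ] (K →L[ℂ] K)} {N : ℕ} {β : vecSpan π →ₗ[ℂ] StrongDual ℂ (MatAlg N)}
    {Sf : Finset (vecSpan π)} {Sx : Finset A} {ε : ℝ}
    (h : ∀ Y : Submodule ℂ A, TopologicalSpace.IsSeparable (Y : Set A) →
      HasSection β Sf Sx ε Y) :
    ∃ α : A →ₗ[ℂ] MatAlg N, (∀ x, ‖α x‖ ≤ ‖x‖) ∧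
      ∀ f ∈ Sf, ∀ x ∈ Sx, ‖β f (α x) - (f : StrongDual ℂ A) x‖ ≤ ε := by
  classical
  let U : Ultrafilter (Finset A) := Ultrafilter.of Filter.atTop
  have hU : ∀ x, ∀ᶠ E : Finset A in U, x ∈ Submodule.span ℂ (E : Set A) := by
    intro x
    refine Ultrafilter.of_le _ ?_
    filter_upwards [Filter.eventually_ge_atTop {x}] with E hE
    exact Submodule.subset_span (hE (Finset.mem_singleton_self x))
  choose α hα hαt using fun E : Finset A => h (Submodule.span ℂ (E : Set A))
    ((Set.Countable.isSeparable E.countable_toSet).span (R := ℂ))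
  let g : Finset A → A → MatAlg N := fun E x =>
    if hx : x ∈ Submodule.span ℂ (E : Set A) then α E ⟨x, hx⟩ else 0
  have hg : ∀ E x, ‖g E x‖ ≤ ‖x‖ := by
    intro E x
    by_cases hx : x ∈ Submodule.span ℂ (E : Set A)
    · simp only [g, dif_pos hx]; exact hα E _
    · simp [g, dif_neg hx]
  have : ProperSpace (MatAlg N) := FiniteDimensional.proper_rclike ℂ _
  obtain ⟨L, hL⟩ := exists_linear_limit U g (fun v w => by
      filter_upwards [hU v, hU w] with E hv hw
      simp only [g, dif_pos hv, dif_pos hw, dif_pos (Submodule.add_mem _ hv hw)]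
      rw [← map_add]; rfl) (fun c v => by
      filter_upwards [hU v] with E hv
      simp only [g, dif_pos hv, dif_pos (Submodule.smul_mem _ c hv)]
      rw [← map_smul]; rfl) fun v => ⟨‖v‖, .of_forall fun E => hg E v⟩
  refine ⟨L, fun x => le_of_tendsto (hL x).norm (.of_forall fun E => hg E x), fun f hf x hx => ?_⟩
  refine le_of_tendsto ((((β f).continuous.tendsto _).comp (hL x)).sub_const _).norm ?_
  filter_upwards [hU x] with E hE
  simp only [Function.comp, g, dif_pos hE]
  exact hαt E f hf x hx hE

end Core

section Core

variable {K : Type u} [NormedAddCommGroup K] [InnerProductSpace ℂ K] [CompleteSpace K]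

/-- On a finite dimensional space, finitely many functionals of norm one determine the norm up to a
factor close to one. -/
lemma exists_finset_norming (G : Type*) [NormedAddCommGroup G] [NormedSpace ℂ G]
    [FiniteDimensional ℂ G] {δ : ℝ} (hδ : 0 < δ) :
    ∃ Γ : Finset (StrongDual ℂ G), (∀ γ ∈ Γ, ‖γ‖ ≤ 1) ∧
      ∀ (g : G) (C : ℝ), 0 ≤ C → (∀ γ ∈ Γ, ‖γ g‖ ≤ C) → ‖g‖ ≤ (1 + δ) * C := by
  have : ProperSpace G := FiniteDimensional.proper_rclike ℂ G
  have hδ1 : (1 + δ)⁻¹ < 1 := inv_lt_one_of_one_lt₀ (by linarith)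
  obtain ⟨t, ht⟩ := (isCompact_sphere (0 : G) 1).elim_finite_subcover
    (fun γ : {γ : StrongDual ℂ G // ‖γ‖ ≤ 1} => {g | (1 + δ)⁻¹ < ‖γ.1 g‖})
    (fun γ => isOpen_lt continuous_const γ.1.continuous.norm) (fun g hg => by
      have hg1 : ‖g‖ = 1 := by simpa using hg
      obtain ⟨γ, hγ, hγg⟩ := exists_dual_vector ℂ g (norm_ne_zero_iff.1 (by rw [hg1]; simp))
      refine Set.mem_iUnion.2 ⟨⟨γ, hγ.le⟩, ?_⟩
      simpa [hγg, hg1] using hδ1)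
  classical
  refine ⟨t.image Subtype.val, fun γ hγ => ?_, fun g C hC hg => ?_⟩
  · obtain ⟨γ, -, rfl⟩ := Finset.mem_image.1 hγ
    exact γ.2
  · by_cases h0 : g = 0
    · rw [h0, norm_zero]; positivity
    have hn : 0 < ‖g‖ := norm_pos_iff.2 h0
    obtain ⟨γ, hγt, hγ⟩ := Set.mem_iUnion₂.1 (ht (show ((‖g‖⁻¹ : ℝ) : ℂ) • g ∈ _ by
      rw [mem_sphere_zero_iff_norm, norm_smul, Complex.norm_real, norm_inv, norm_norm]
      exact inv_mul_cancel₀ hn.ne'))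
    have h1 := hg γ.1 (Finset.mem_image_of_mem _ hγt)
    rw [Set.mem_ofPred_eq, map_smul, norm_smul, Complex.norm_real, norm_inv, norm_norm,
      lt_inv_mul_iff₀ hn] at hγ
    have h2 : ‖g‖ * (1 + δ)⁻¹ ≤ C := hγ.le.trans h1
    rw [← div_eq_mul_inv, div_le_iff₀ (by positivity)] at h2
    linarith

/-- A map `α` with values in a normed space is a finite sum of vector functionals in every
coordinate. -/
def IsVecNormal {A : Type*} [NonUnitalCStarAlgebra A] (π : A →⋆ₙₐ[ℂ] (K →L[ℂ] K)) {G : Type*}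
    [NormedAddCommGroup G] [NormedSpace ℂ G] (α : A →ₗ[ℂ] G) : Prop :=
  ∀ γ : StrongDual ℂ G, ∃ f : vecSpan π, ∀ x, γ (α x) = (f : StrongDual ℂ A) x

/-- Local reflexivity applied to a contraction into a finite dimensional space: it is approximated
on finite sets by normal maps of almost the same norm. -/
lemma IsWeaklyClosedRep.exists_isVecNormal_approx {A : Type*} [NonUnitalCStarAlgebra A]
    {π : A →⋆ₙₐ[ℂ] (K →L[ℂ] K)} (hπ : IsWeaklyClosedRep π) {G : Type*} [NormedAddCommGroup G]
    [NormedSpace ℂ G] [FiniteDimensional ℂ G] (α : A →ₗ[ℂ] G) (hα : ∀ x, ‖α x‖ ≤ ‖x‖)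
    (Sx : Finset A) {δ : ℝ} (hδ : 0 < δ) :
    ∃ α' : A →ₗ[ℂ] G, IsVecNormal π α' ∧ (∀ x, ‖α' x‖ ≤ (1 + δ) * ‖x‖) ∧
      ∀ x ∈ Sx, ‖α' x - α x‖ ≤ δ := by
  let _ : PartialOrder A := CStarAlgebra.spectralOrder A
  have : StarOrderedRing A := CStarAlgebra.spectralOrderedRing A
  obtain ⟨Γ, hΓ, hΓn⟩ := exists_finset_norming G hδ
  let φ : StrongDual ℂ G →ₗ[ℂ] A →ₗ[ℂ] ℂ :=
    { toFun := fun γ => γ.toLinearMap ∘ₗ α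
      map_add' := fun _ _ => rfl
      map_smul' := fun _ _ => rfl }
  have hφ : ∀ γ x, φ γ x = γ (α x) := fun _ _ => rfl
  obtain ⟨ψ, hψ, hψt⟩ := hπ.exists_vecSpan_approx φ (fun _ : Γ => 1) (fun γ _ _ => γ.1)
    (fun γ a => by
      simp only [Finset.univ_unique, Finset.sum_singleton, hφ]
      calc ‖γ.1 (α (a 0 0))‖ ≤ ‖γ.1‖ * ‖α (a 0 0)‖ := γ.1.le_opNorm _
        _ ≤ 1 * ‖a 0 0‖ := by gcongr; exacts [hΓ _ γ.2, hα _]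
        _ ≤ ‖a‖ := by rw [one_mul]; exact CStarMatrix.norm_entry_le_norm)
    (fun k : Γ × Sx => k.1.1) (fun k : Γ × Sx => k.2.1) (div_pos hδ (by linarith : 0 < 1 + δ))
  let b := Module.finBasis ℂ G
  let c : Fin (Module.finrank ℂ G) → StrongDual ℂ G := fun j =>
    LinearMap.toContinuousLinearMap (b.coord j)
  let α' : A →ₗ[ℂ] G := ∑ j, ((ψ (c j) : StrongDual ℂ A).toLinearMap).smulRight (b j)
  have hα' : ∀ γ x, γ (α' x) = (ψ γ : StrongDual ℂ A) x := by
    intro γ x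
    have hγ : γ = ∑ j, γ (b j) • c j := by
      ext g
      conv_lhs => rw [← b.sum_repr g, map_sum]
      rw [sum_apply]
      refine Finset.sum_congr rfl fun j _ => ?_
      rw [map_smul, smul_apply, smul_eq_mul, smul_eq_mul, mul_comm]
      rfl
    conv_rhs => rw [hγ]
    simp only [α', LinearMap.sum_apply, map_sum, LinearMap.smulRight_apply, map_smul,
      AddSubmonoidClass.coe_finsetSum, sum_apply, Submodule.coe_smul, smul_apply, smul_eq_mul]
    exact Finset.sum_congr rfl fun j _ => mul_comm _ _
  refine ⟨α', fun γ => ⟨ψ γ, hα' γ⟩, fun x => ?_, fun x hx => ?_⟩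
  · refine hΓn _ _ (norm_nonneg x) fun γ hγ => ?_
    rw [hα']
    have := hψ ⟨γ, hγ⟩ (CStarMatrix.ofMatrix (Matrix.of fun _ _ => x))
    simp only [Finset.univ_unique, Finset.sum_singleton] at this
    exact this.trans (norm_oneByOne_le x)
  · refine (hΓn _ (δ / (1 + δ)) (by positivity) fun γ hγ => ?_).trans_eq
      (mul_div_cancel₀ δ (by positivity))
    rw [map_sub, hα']
    exact (hψt (⟨γ, hγ⟩, ⟨x, hx⟩)).le

lemma norm_inv_smul_sub_le {G : Type*} [NormedAddCommGroup G] [NormedSpace ℂ G] {δ R : ℝ}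
    (hδ : 0 < δ) {a b : G} (hb : ‖b‖ ≤ R) (hab : ‖a - b‖ ≤ δ) :
    ‖(((1 + δ)⁻¹ : ℝ) : ℂ) • a - b‖ ≤ δ * (1 + R) := by
  have hδ1 : (0 : ℝ) < 1 + δ := by linarith
  have hR : 0 ≤ R := (norm_nonneg b).trans hb
  have e : (((1 + δ)⁻¹ : ℝ) : ℂ) • a - b = (((1 + δ)⁻¹ : ℝ) : ℂ) • ((a - b) - (δ : ℂ) • b) := by
    have h2 : b = (((1 + δ)⁻¹ : ℝ) : ℂ) • ((1 + δ : ℝ) : ℂ) • b := by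
      rw [smul_smul, ← Complex.ofReal_mul, inv_mul_cancel₀ hδ1.ne', Complex.ofReal_one, one_smul]
    conv_lhs => rw [h2]
    rw [← smul_sub]
    congr 1
    push_cast
    module
  rw [e, norm_smul, Complex.norm_real, Real.norm_of_nonneg (by positivity), inv_mul_le_iff₀ hδ1]
  have h3 : ‖(a - b) - (δ : ℂ) • b‖ ≤ δ + δ * R := by
    refine (norm_sub_le _ _).trans (add_le_add hab ?_)
    rw [norm_smul, Complex.norm_real, Real.norm_of_nonneg hδ.le]
    gcongr
  nlinarith [mul_nonneg hδ.le hδ.le, mul_nonneg (mul_nonneg hδ.le hδ.le) hR]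

/-- A contraction into a finite dimensional space is approximated on finite sets by normal
contractions. -/
lemma IsWeaklyClosedRep.exists_isVecNormal_contraction {A : Type*} [NonUnitalCStarAlgebra A]
    {π : A →⋆ₙₐ[ℂ] (K →L[ℂ] K)} (hπ : IsWeaklyClosedRep π) {G : Type*} [NormedAddCommGroup G]
    [NormedSpace ℂ G] [FiniteDimensional ℂ G] (α : A →ₗ[ℂ] G) (hα : ∀ x, ‖α x‖ ≤ ‖x‖)
    (Sx : Finset A) {ε : ℝ} (hε : 0 < ε) :
    ∃ α' : A →ₗ[ℂ] G, IsVecNormal π α' ∧ (∀ x, ‖α' x‖ ≤ ‖x‖) ∧ ∀ x ∈ Sx, ‖α' x - α x‖ ≤ ε := by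
  set R : ℝ := ∑ x ∈ Sx, ‖x‖ with hR
  have hR0 : 0 ≤ R := Finset.sum_nonneg fun _ _ => norm_nonneg _
  obtain ⟨δ, hδ, hδε⟩ : ∃ δ > 0, δ * (1 + R) ≤ ε :=
    ⟨ε / (1 + R), by positivity, (div_mul_cancel₀ ε (by positivity)).le⟩
  obtain ⟨α', hα', hαn, hαx⟩ := hπ.exists_isVecNormal_approx α hα Sx hδ
  have hδ1 : (0 : ℝ) < 1 + δ := by linarith
  refine ⟨(((1 + δ)⁻¹ : ℝ) : ℂ) • α', fun γ => ?_, fun x => ?_, fun x hx => ?_⟩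
  · obtain ⟨f, hf⟩ := hα' γ
    refine ⟨(((1 + δ)⁻¹ : ℝ) : ℂ) • f, fun x => ?_⟩
    rw [LinearMap.smul_apply, map_smul, hf]
    rfl
  · rw [LinearMap.smul_apply, norm_smul, Complex.norm_real, Real.norm_of_nonneg (by positivity),
      inv_mul_le_iff₀ hδ1]
    exact hαn x
  · have hxR : ‖x‖ ≤ R := Finset.single_le_sum (f := fun x => ‖x‖) (fun _ _ => norm_nonneg _) hx
    exact (norm_inv_smul_sub_le hδ ((hα x).trans hxR) (hαx x hx)).trans hδε

/-- Liftings of a separable subspace `Y`, composed with the factorization through `B(H)` given by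
the WEP, yield a contraction `s : Y → B(H)` that the complete contraction `T : B(H) → A` inverts;
the finite dimensional approximation of `T` then has a section on `Y`. -/
lemma exists_hasSection {A : Type*} [NonUnitalCStarAlgebra A] (π : A →⋆ₙₐ[ℂ] (K →L[ℂ] K))
    {H : Type*} [NormedAddCommGroup H] [InnerProductSpace ℂ H] [CompleteSpace H]
    (T : (H →L[ℂ] H) →ₗ[ℂ] A)
    (hT : ∀ (n : ℕ) (a : CStarMatrix (Fin n) (Fin n) (H →L[ℂ] H))
      (ξ η : PiLp 2 (fun _ : Fin n => K)), ‖ξ‖ ≤ 1 → ‖η‖ ≤ 1 →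
        ‖∑ i, ∑ j, inner ℂ (ξ i) (π (T (a i j)) (η j))‖ ≤ ‖a‖)
    (Y : Submodule ℂ A) (s : Y →ₗ[ℂ] (H →L[ℂ] H)) (hs : ∀ x, ‖s x‖ ≤ ‖x‖)
    (hTs : ∀ x, T (s x) = x) (Sf : Finset (vecSpan π)) (Sx : Finset A)
    (C : Finset (Constr K)) {ε : ℝ} (hε : 0 < ε) :
    ∃ (N : ℕ) (β : vecSpan π →ₗ[ℂ] StrongDual ℂ (MatAlg N)),
      (∀ c ∈ C, SatisfiesConstr π β c) ∧ HasSection β Sf Sx ε Y := by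
  classical
  let s' : A → (H →L[ℂ] H) := fun x => if h : x ∈ Y then s ⟨x, h⟩ else 0
  obtain ⟨N, J, β, hβ, hβt⟩ := exists_matAlg_approx π T hT Sf (Sx.image s') C hε
  refine ⟨N, β, hβ, compress J.toContinuousLinearMap ∘ₗ s, fun x =>
    (norm_compress_le J.norm_toContinuousLinearMap_le _).trans (hs x), fun f hf x hx hxY => ?_⟩
  have h1 := hβt f hf (s' x) (Finset.mem_image_of_mem s' hx)
  have h2 : s' x = s ⟨x, hxY⟩ := dif_pos hxY
  rw [h2, hTs] at h1
  exact h1.le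

/-- The local form of the factorization: on given finite sets of functionals and of elements,
the identity of `A` factors approximately as a normal contraction `α` into a matrix algebra
followed by (the adjoint of) a map `β` satisfying finitely many matricial constraints. -/
lemma IsWeaklyClosedRep.exists_local_factorization {A : Type*} [NonUnitalCStarAlgebra A]
    {π : A →⋆ₙₐ[ℂ] (K →L[ℂ] K)} (hπ : IsWeaklyClosedRep π)
    {H : Type*} [NormedAddCommGroup H] [InnerProductSpace ℂ H] [CompleteSpace H]
    (T : (H →L[ℂ] H) →ₗ[ℂ] A)
    (hT : ∀ (n : ℕ) (a : CStarMatrix (Fin n) (Fin n) (H →L[ℂ] H))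
      (ξ η : PiLp 2 (fun _ : Fin n => K)), ‖ξ‖ ≤ 1 → ‖η‖ ≤ 1 →
        ‖∑ i, ∑ j, inner ℂ (ξ i) (π (T (a i j)) (η j))‖ ≤ ‖a‖)
    (hs : ∀ Y : Submodule ℂ A, IsClosed (Y : Set A) → TopologicalSpace.IsSeparable (Y : Set A) →
      ∃ s : Y →ₗ[ℂ] (H →L[ℂ] H), (∀ x, ‖s x‖ ≤ ‖x‖) ∧ ∀ x, T (s x) = x)
    (Sf : Finset (vecSpan π)) (Sx : Finset A) (C : Finset (Constr K)) {ε : ℝ} (hε : 0 < ε) :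
    ∃ (N : ℕ) (α : A →ₗ[ℂ] MatAlg N) (β : vecSpan π →ₗ[ℂ] StrongDual ℂ (MatAlg N)),
      (∀ c ∈ C, SatisfiesConstr π β c) ∧ IsVecNormal π α ∧
      (∀ x, ‖α x‖ ≤ ‖x‖) ∧ ∀ f ∈ Sf, ∀ x ∈ Sx, ‖β f (α x) - (f : StrongDual ℂ A) x‖ ≤ ε := by
  obtain ⟨N, β, hβ, hsec⟩ := exists_uniform_hasSection π Sf Sx (half_pos hε)
    (fun N β => ∀ c ∈ C, SatisfiesConstr π β c) fun Y hYc hYs => by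
      obtain ⟨s, hs, hTs⟩ := hs Y hYc hYs
      exact exists_hasSection π T hT Y s hs hTs Sf Sx C (half_pos (half_pos hε))
  obtain ⟨α, hα, hαt⟩ := exists_global_section hsec
  set B : ℝ := ∑ f ∈ Sf, ‖β f‖ with hB
  have hB0 : 0 ≤ B := Finset.sum_nonneg fun f _ => norm_nonneg (β f)
  obtain ⟨δ, hδ, hδε⟩ : ∃ δ > 0, B * δ ≤ ε / 2 :=
    ⟨ε / 2 / (B + 1), by positivity, by
      rw [mul_div_assoc', div_le_iff₀ (by positivity)]; nlinarith⟩
  obtain ⟨α', hα', hαn, hαx⟩ :=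
    hπ.exists_isVecNormal_contraction α hα Sx hδ
  refine ⟨N, α', β, hβ, hα', hαn, fun f hf x hx => ?_⟩
  have hfB : ‖β f‖ ≤ B := Finset.single_le_sum (f := fun f => ‖β f‖) (fun f _ => norm_nonneg (β f)) hf
  have h4 : ‖β f (α' x - α x)‖ ≤ ε / 2 :=
    ((β f).le_opNorm _).trans (le_trans (mul_le_mul hfB (hαx x hx) (norm_nonneg _) hB0) hδε)
  have h5 := hαt f hf x hx
  have h6 : β f (α' x) - (f : StrongDual ℂ A) x = β f (α' x - α x) +
      (β f (α x) - (f : StrongDual ℂ A) x) := by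
    rw [map_sub]; ring
  rw [h6]
  linarith [norm_add_le (β f (α' x - α x)) (β f (α x) - (f : StrongDual ℂ A) x)]

end Core

/-! ### Normal functionals and normal maps -/

section Normal

lemma norm_le_of_forall_inner_le {K : Type*} [NormedAddCommGroup K]
    [InnerProductSpace ℂ K] {T : K →L[ℂ] K} {C : ℝ} (hC : 0 ≤ C)
    (h : ∀ ξ η, ‖inner ℂ ξ (T η)‖ ≤ C * ‖ξ‖ * ‖η‖) : ‖T‖ ≤ C := by
  refine T.opNorm_le_bound hC fun η => ?_
  by_cases h0 : T η = 0
  · rw [h0, norm_zero]; positivity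
  have hn : 0 < ‖T η‖ := norm_pos_iff.2 h0
  have h1 := h (T η) η
  rw [inner_self_eq_norm_sq_to_K] at h1
  have h2 : ‖T η‖ ^ 2 ≤ C * ‖T η‖ * ‖η‖ := by simpa using h1
  nlinarith

/-- A summable family of pairs of vectors indexed by a countable type can be re-indexed by `ℕ`. -/
lemma exists_lp_reindex {K : Type*} [NormedAddCommGroup K] [InnerProductSpace ℂ K]
    {ι : Type*} [Countable ι] (ξ η : ι → K)
    (hξ : Summable fun i => ‖ξ i‖ ^ 2) (hη : Summable fun i => ‖η i‖ ^ 2) :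
    ∃ ξ' η' : lp (fun _ : ℕ => K) 2, ∀ T : K →L[ℂ] K,
      ∑' n, inner ℂ (ξ' n) (T (η' n)) = ∑' i, inner ℂ (ξ i) (T (η i)) := by
  obtain ⟨e, he⟩ := exists_injective_nat ι
  have hmem : ∀ ζ : ι → K, Summable (fun i => ‖ζ i‖ ^ 2) →
      Memℓp (Function.extend e ζ 0) 2 := by
    intro ζ hζ
    refine memℓp_gen ?_
    have h1 : (fun n => ‖Function.extend e ζ 0 n‖ ^ (2 : ENNReal).toReal) =
        Function.extend e (fun i => ‖ζ i‖ ^ 2) 0 := by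
      ext n
      by_cases hn : ∃ i, e i = n
      · obtain ⟨i, rfl⟩ := hn
        rw [he.extend_apply, he.extend_apply]
        simp
      · rw [Function.extend_apply' _ _ _ hn, Function.extend_apply' _ _ _ hn]
        simp
    rw [h1]
    exact (summable_extend_zero he).2 hζ
  refine ⟨⟨_, hmem ξ hξ⟩, ⟨_, hmem η hη⟩, fun T => ?_⟩
  rw [← tsum_extend_zero he]
  refine tsum_congr fun n => ?_
  change inner ℂ (Function.extend e ξ 0 n) (T (Function.extend e η 0 n)) = _
  by_cases hn : ∃ i, e i = n
  · obtain ⟨i, rfl⟩ := hn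
    rw [he.extend_apply, he.extend_apply, he.extend_apply]
  · rw [Function.extend_apply' _ _ _ hn, Function.extend_apply' _ _ _ hn,
      Function.extend_apply' _ _ _ hn]
    simp

variable {A : Type*} [NonUnitalCStarAlgebra A] {K : Type*} [NormedAddCommGroup K]
  [InnerProductSpace ℂ K] [CompleteSpace K]

/-- The predual of `A`: the norm closure of the finite sums of vector functionals. -/
def predual (π : A →⋆ₙₐ[ℂ] (K →L[ℂ] K)) : Submodule ℂ (StrongDual ℂ A) :=
  (vecSpan π).topologicalClosure

lemma vecSpan_le_predual (π : A →⋆ₙₐ[ℂ] (K →L[ℂ] K)) : vecSpan π ≤ predual π :=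
  Submodule.le_topologicalClosure _

/-- Sums of absolutely convergent series in the predual belong to the predual. -/
lemma mem_predual_of_hasSum {π : A →⋆ₙₐ[ℂ] (K →L[ℂ] K)} {ι : Type*} (c : ι → StrongDual ℂ A)
    (hc : ∀ i, c i ∈ predual π) {b : ι → ℝ} (hb : Summable b) (hcb : ∀ i, ‖c i‖ ≤ b i)
    (F : StrongDual ℂ A) (hF : ∀ x, HasSum (fun i => c i x) (F x)) : F ∈ predual π := by
  have hs : Summable c := .of_norm_bounded hb hcb
  have h1 : F = ∑' i, c i := by
    ext x
    refine (hF x).unique ?_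
    exact hs.hasSum.mapL (ContinuousLinearMap.apply ℂ ℂ x)
  rw [h1]
  exact (Submodule.isClosed_topologicalClosure (vecSpan π)).mem_of_tendsto hs.hasSum
    (.of_forall fun s => Submodule.sum_mem _ fun i _ => hc i)

/-- The finite sums of vector functionals given by two families of vectors, both of `ℓ²`-norm
squared at most `r`. -/
def vecBall (π : A →⋆ₙₐ[ℂ] (K →L[ℂ] K)) (r : ℝ) : Set (StrongDual ℂ A) :=
  {f | ∃ (ι : Type) (_ : Fintype ι) (ξ η : ι → K), ∑ i, ‖ξ i‖ ^ 2 ≤ r ∧ ∑ i, ‖η i‖ ^ 2 ≤ r ∧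
    f = ∑ i, vecFun π (ξ i) (η i)}

lemma vecFun_smul (π : A →⋆ₙₐ[ℂ] (K →L[ℂ] K)) (c d : ℝ) (ξ η : K) :
    vecFun π ((c : ℂ) • ξ) ((d : ℂ) • η) = (c * d : ℝ) • vecFun π ξ η := by
  ext x
  simp [mul_left_comm, mul_assoc]

lemma convex_vecBall (π : A →⋆ₙₐ[ℂ] (K →L[ℂ] K)) (r : ℝ) : Convex ℝ (vecBall π r) := by
  rintro _ ⟨ι, _, ξ, η, hξ, hη, rfl⟩ _ ⟨ι', _, ξ', η', hξ', hη', rfl⟩ a b ha hb hab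
  have hn : ∀ c : ℝ, 0 ≤ c → ∀ x : K, ‖((√c : ℝ) : ℂ) • x‖ ^ 2 = c * ‖x‖ ^ 2 := by
    intro c hc x
    rw [norm_smul, mul_pow, Complex.norm_real, Real.norm_of_nonneg (Real.sqrt_nonneg c),
      Real.sq_sqrt hc]
  refine ⟨ι ⊕ ι', inferInstance, Sum.elim (fun i => ((√a : ℝ) : ℂ) • ξ i)
    (fun i => ((√b : ℝ) : ℂ) • ξ' i), Sum.elim (fun i => ((√a : ℝ) : ℂ) • η i)
    (fun i => ((√b : ℝ) : ℂ) • η' i), ?_, ?_, ?_⟩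
  · simp only [Fintype.sum_sum_type, Sum.elim_inl, Sum.elim_inr, hn a ha, hn b hb,
      ← Finset.mul_sum]
    calc _ ≤ a * r + b * r := by gcongr
      _ = r := by rw [← add_mul, hab, one_mul]
  · simp only [Fintype.sum_sum_type, Sum.elim_inl, Sum.elim_inr, hn a ha, hn b hb,
      ← Finset.mul_sum]
    calc _ ≤ a * r + b * r := by gcongr
      _ = r := by rw [← add_mul, hab, one_mul]
  · simp only [Fintype.sum_sum_type, Sum.elim_inl, Sum.elim_inr, vecFun_smul,
      Real.mul_self_sqrt ha, Real.mul_self_sqrt hb, Finset.smul_sum]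

/-- The unit ball of the predual is the closure of the trace class functionals of trace norm at
most one: by the Hahn–Banach theorem, as `A` is the dual of its predual. -/
lemma IsWeaklyClosedRep.mem_closure_vecBall {π : A →⋆ₙₐ[ℂ] (K →L[ℂ] K)}
    (hπ : IsWeaklyClosedRep π) {r : ℝ} (hr : 0 < r) {f : StrongDual ℂ A} (hf : f ∈ predual π)
    (hfr : ‖f‖ ≤ r) : f ∈ closure (vecBall π r) := by
  by_contra hcon
  obtain ⟨Φ, s, hs, hsf⟩ := RCLike.geometric_hahn_banach_closed_point (𝕜 := ℂ)
    (convex_vecBall π r).closure isClosed_closure hcon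
  have hs0 : 0 ≤ s := by
    have := hs 0 (subset_closure ⟨Empty, inferInstance, fun _ => 0, fun _ => 0, by simpa using hr.le,
      by simpa using hr.le, by simp⟩)
    simpa using this.le
  obtain ⟨y, hy⟩ := hπ.exists_eval (Φ.toLinearMap ∘ₗ (vecSpan π).subtype) ‖Φ‖ fun ξ η => by
    refine (Φ.le_opNorm _).trans ?_
    rw [mul_assoc]
    gcongr
    exact norm_vecFun_le π ξ η
  have hy' : ∀ g ∈ predual π, Φ g = g y := by
    intro g hg
    have hcl : IsClosed {g : StrongDual ℂ A | Φ g = g y} :=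
      isClosed_eq Φ.continuous (ContinuousLinearMap.apply ℂ ℂ y).continuous
    exact closure_minimal (fun g hg => hy ⟨g, hg⟩) hcl hg
  have hv : ∀ ξ η, ‖ξ‖ ^ 2 ≤ r → ‖η‖ ^ 2 ≤ r → ‖inner ℂ ξ (π y η)‖ ≤ s := by
    intro ξ η hξ hη
    set z : ℂ := inner ℂ ξ (π y η) with hz
    -- rotating `η` makes the matrix coefficient positive
    obtain ⟨c, hc, hcz⟩ := RCLike.exists_norm_eq_mul_self z
    have h1 := hs (vecFun π ξ (c • η)) (subset_closure
      ⟨Unit, inferInstance, fun _ => ξ, fun _ => c • η, by simpa using hξ, by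
        simpa [norm_smul, hc] using hη, by simp⟩)
    rw [hy' _ (vecSpan_le_predual π (vecFun_mem π _ _)), vecFun_apply, map_smul,
      inner_smul_right, ← hz, ← hcz] at h1
    have h3 : ‖z‖ < s := by simpa using h1
    exact h3.le
  have hyn : ‖y‖ ≤ s / r := by
    rw [← NonUnitalStarAlgHom.norm_map π hπ.injective]
    refine norm_le_of_forall_inner_le (by positivity) fun ξ η => ?_
    by_cases hξ : ξ = 0
    · simp [hξ]
    by_cases hη : η = 0
    · simp [hη]
    have hξ' : 0 < ‖ξ‖ := norm_pos_iff.2 hξ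
    have hη' : 0 < ‖η‖ := norm_pos_iff.2 hη
    have hsc : ∀ x : K, 0 < ‖x‖ → ‖((√r / ‖x‖ : ℝ) : ℂ) • x‖ ^ 2 ≤ r := by
      intro x hx
      rw [norm_smul, Complex.norm_real, Real.norm_of_nonneg (by positivity),
        div_mul_cancel₀ _ hx.ne', Real.sq_sqrt hr.le]
    have := hv _ _ (hsc ξ hξ') (hsc η hη')
    rw [map_smul, inner_smul_left, inner_smul_right, Complex.conj_ofReal, norm_mul, norm_mul,
      Complex.norm_real, Complex.norm_real, Real.norm_of_nonneg (by positivity),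
      Real.norm_of_nonneg (by positivity)] at this
    have h2 : √r * √r = r := Real.mul_self_sqrt hr.le
    have h3 : √r / ‖ξ‖ * (√r / ‖η‖ * ‖inner ℂ ξ (π y η)‖) =
        r * ‖inner ℂ ξ (π y η)‖ / (‖ξ‖ * ‖η‖) := by
      field_simp
      rw [Real.sq_sqrt hr.le, mul_comm]
    rw [h3, div_le_iff₀ (by positivity)] at this
    rw [div_mul_eq_mul_div, div_mul_eq_mul_div, le_div_iff₀ hr]
    linarith
  have h5 : ‖f y‖ ≤ s := by
    calc ‖f y‖ ≤ ‖f‖ * ‖y‖ := f.le_opNorm y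
      _ ≤ r * (s / r) := by gcongr
      _ = s := by field_simp
  rw [hy' f hf] at hsf
  have h6 : s < (f y).re := hsf
  linarith [Complex.re_le_norm (f y)]

lemma vecBall_subset_vecSpan (π : A →⋆ₙₐ[ℂ] (K →L[ℂ] K)) (r : ℝ) :
    vecBall π r ⊆ vecSpan π := by
  rintro _ ⟨ι, _, ξ, η, -, -, rfl⟩
  exact Submodule.sum_mem _ fun i _ => vecFun_mem π _ _

/-- Every functional in the predual is the sum of a series of finite sums of vector functionals of
geometrically decreasing trace norm. -/
lemma IsWeaklyClosedRep.exists_series {π : A →⋆ₙₐ[ℂ] (K →L[ℂ] K)} (hπ : IsWeaklyClosedRep π)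
    {f : StrongDual ℂ A} (hf : f ∈ predual π) :
    ∃ (r : ℕ → ℝ) (g : ℕ → StrongDual ℂ A), Summable r ∧ (∀ m, g m ∈ vecBall π (r m)) ∧
      ∀ x, HasSum (fun m => g m x) (f x) := by
  let r : ℕ → ℝ := fun m => (‖f‖ + 1) * (1 / 2) ^ m
  have hr : ∀ m, 0 < r m := fun m => by positivity
  have hrs : Summable r := summable_geometric_two.mul_left _
  have step : ∀ m, ∀ h : {h : StrongDual ℂ A // h ∈ predual π ∧ ‖h‖ ≤ r m},
      ∃ k : {h : StrongDual ℂ A // h ∈ predual π ∧ ‖h‖ ≤ r (m + 1)},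
        h.1 - k.1 ∈ vecBall π (r m) := by
    rintro m ⟨h, hh, hhr⟩
    obtain ⟨g, hg, hgd⟩ := Metric.mem_closure_iff.1 (hπ.mem_closure_vecBall (hr m) hh hhr) _
      (hr (m + 1))
    refine ⟨⟨h - g, Submodule.sub_mem _ hh (vecSpan_le_predual π (vecBall_subset_vecSpan π _ hg)),
      ?_⟩, ?_⟩
    · rw [← dist_eq_norm]; exact hgd.le
    · rwa [sub_sub_cancel]
  choose next hnext using step
  let R : ∀ m, {h : StrongDual ℂ A // h ∈ predual π ∧ ‖h‖ ≤ r m} := fun m =>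
    Nat.rec ⟨f, hf, by simp [r]⟩ (fun m h => next m h) m
  have hR : ∀ m, (R m).1 - (R (m + 1)).1 ∈ vecBall π (r m) := fun m => hnext m (R m)
  have hsum : ∀ k, ∑ m ∈ Finset.range k, ((R m).1 - (R (m + 1)).1) = f - (R k).1 := fun k =>
    Finset.sum_range_sub' (fun m => (R m).1) k
  have hbound : ∀ m x, ‖((R m).1 - (R (m + 1)).1) x‖ ≤ 2 * r m * ‖x‖ := by
    intro m x
    refine (ContinuousLinearMap.le_opNorm _ _).trans ?_
    gcongr
    refine (norm_sub_le _ _).trans ?_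
    have h1 := (R m).2.2
    have h2 := (R (m + 1)).2.2
    have h3 : r (m + 1) ≤ r m := by
      simp only [r, pow_succ]
      have : 0 ≤ (‖f‖ + 1) * (1 / 2) ^ m := by positivity
      linarith
    linarith
  refine ⟨r, fun m => (R m).1 - (R (m + 1)).1, hrs, hR, fun x => ?_⟩
  have hs : Summable fun m => ((R m).1 - (R (m + 1)).1) x :=
    .of_norm_bounded ((hrs.mul_left 2).mul_right ‖x‖) fun m => hbound m x
  refine (hs.hasSum_iff_tendsto_nat).2 ?_
  have h0 : Filter.Tendsto (fun k => (R k).1 x) Filter.atTop (𝓝 0) := by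
    refine squeeze_zero_norm (fun k => ?_)
      (by simpa using hrs.tendsto_atTop_zero.mul_const ‖x‖)
    exact ContinuousLinearMap.le_of_opNorm_le _ (R k).2.2 x
  have h1 : ∀ k, ∑ m ∈ Finset.range k, ((R m).1 - (R (m + 1)).1) x = f x - (R k).1 x := by
    intro k
    rw [← sub_apply, ← hsum, sum_apply]
  simp only [h1]
  simpa using h0.const_sub (f x)

/-- Every functional in the predual is given by two square summable sequences of vectors. -/
lemma IsWeaklyClosedRep.exists_lp {π : A →⋆ₙₐ[ℂ] (K →L[ℂ] K)} (hπ : IsWeaklyClosedRep π)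
    {f : StrongDual ℂ A} (hf : f ∈ predual π) :
    ∃ ξ η : lp (fun _ : ℕ => K) 2, ∀ x, f x = ∑' n, inner ℂ (ξ n) (π x (η n)) := by
  obtain ⟨r, g, hr, hg, hfg⟩ := hπ.exists_series hf
  choose ι hι ξ η hξ hη hgs using hg
  have hsum : ∀ ζ : ∀ m, ι m → K, (∀ m, ∑ i, ‖ζ m i‖ ^ 2 ≤ r m) →
      Summable fun p : Σ m, ι m => ‖ζ p.1 p.2‖ ^ 2 := by
    intro ζ hζ
    refine (summable_sigma_of_nonneg fun p => by positivity).2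
      ⟨fun m => Summable.of_finite, ?_⟩
    refine Summable.of_nonneg_of_le (fun m => tsum_nonneg fun i => by positivity) (fun m => ?_) hr
    rw [tsum_fintype]
    exact hζ m
  obtain ⟨ξ', η', h⟩ := exists_lp_reindex (fun p : Σ m, ι m => ξ p.1 p.2) (fun p => η p.1 p.2)
    (hsum ξ hξ) (hsum η hη)
  refine ⟨ξ', η', fun x => ?_⟩
  rw [h]
  have hs : Summable fun p : Σ m, ι m => inner ℂ (ξ p.1 p.2) (π x (η p.1 p.2)) := by
    refine .of_norm_bounded (((hsum ξ hξ).add (hsum η hη)).mul_left ‖x‖) fun p => ?_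
    refine (norm_inner_le_norm _ _).trans ?_
    have h1 : ‖π x (η p.1 p.2)‖ ≤ ‖x‖ * ‖η p.1 p.2‖ :=
      (π x).le_of_opNorm_le (NonUnitalStarAlgHom.norm_apply_le π x) _
    have h2 : ‖ξ p.1 p.2‖ * ‖η p.1 p.2‖ ≤ ‖ξ p.1 p.2‖ ^ 2 + ‖η p.1 p.2‖ ^ 2 := by
      nlinarith [sq_nonneg (‖ξ p.1 p.2‖ - ‖η p.1 p.2‖), sq_nonneg ‖ξ p.1 p.2‖,
        sq_nonneg ‖η p.1 p.2‖]
    calc ‖ξ p.1 p.2‖ * ‖π x (η p.1 p.2)‖ ≤ ‖ξ p.1 p.2‖ * (‖x‖ * ‖η p.1 p.2‖) := by gcongr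
      _ = ‖x‖ * (‖ξ p.1 p.2‖ * ‖η p.1 p.2‖) := by ring
      _ ≤ _ := by gcongr
  rw [hs.tsum_sigma' fun m => Summable.of_finite, ← (hfg x).tsum_eq]
  refine tsum_congr fun m => ?_
  rw [tsum_fintype, hgs m, sum_apply]
  rfl

/-- The functionals in the predual of a von Neumann algebra are ultraweakly continuous. -/
lemma continuous_of_mem_predual (M : VonNeumannAlgebra K)
    {f : StrongDual ℂ M.toStarSubalgebra} (hf : f ∈ predual (vnRep M)) :
    Continuous[TopologicalSpace.induced (Subtype.val : M.toStarSubalgebra → (K →L[ℂ] K))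
      (ultraweakTopology K), inferInstance] f := by
  obtain ⟨ξ, η, h⟩ := (isWeaklyClosedRep_vnRep M).exists_lp hf
  have h1 : (f : M.toStarSubalgebra → ℂ) =
      (fun T : K →L[ℂ] K => ∑' n, inner ℂ (ξ n) (T (η n))) ∘ Subtype.val := funext h
  rw [h1]
  have h2 : Continuous[ultraweakTopology K, inferInstance]
      (fun T : K →L[ℂ] K => ∑' n, inner ℂ (ξ n) (T (η n))) :=
    continuous_iInf_dom (i := ξ) (continuous_iInf_dom (i := η) continuous_induced_dom)
  exact @Continuous.comp _ _ _ (_) (_) _ _ _ h2 continuous_induced_dom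

lemma summable_norm_mul_norm {ι : Type*} {E : ι → Type*} [∀ i, NormedAddCommGroup (E i)]
    (ξ η : lp E 2) : Summable fun i => ‖ξ i‖ * ‖η i‖ := by
  have h : ∀ ζ : lp E 2, Summable fun i => ‖ζ i‖ ^ 2 := by
    intro ζ
    simpa using (lp.memℓp ζ).summable (by norm_num)
  refine Summable.of_nonneg_of_le (fun i => by positivity) (fun i => ?_) ((h ξ).add (h η))
  nlinarith [sq_nonneg (‖ξ i‖ - ‖η i‖), sq_nonneg ‖ξ i‖, sq_nonneg ‖η i‖]

/-- The coefficient functional `x ↦ ⟪ξ, u(x) η⟫` of a contraction `u : A → B(H)`. -/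
def coefFun {H : Type*} [NormedAddCommGroup H] [InnerProductSpace ℂ H] (u : A →ₗ[ℂ] (H →L[ℂ] H))
    (hu : ∀ x, ‖u x‖ ≤ ‖x‖) (ξ η : H) : StrongDual ℂ A :=
  LinearMap.mkContinuous
    { toFun := fun x => inner ℂ ξ (u x η)
      map_add' := fun x y => by simp
      map_smul' := fun c x => by simp } (‖ξ‖ * ‖η‖) fun x => by
    calc ‖inner ℂ ξ (u x η)‖ ≤ ‖ξ‖ * ‖u x η‖ := norm_inner_le_norm _ _
      _ ≤ ‖ξ‖ * (‖x‖ * ‖η‖) := by gcongr; exact (u x).le_of_opNorm_le (hu x) η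
      _ = _ := by ring

lemma norm_coefFun_le {H : Type*} [NormedAddCommGroup H] [InnerProductSpace ℂ H]
    (u : A →ₗ[ℂ] (H →L[ℂ] H)) (hu : ∀ x, ‖u x‖ ≤ ‖x‖) (ξ η : H) :
    ‖coefFun u hu ξ η‖ ≤ ‖ξ‖ * ‖η‖ :=
  LinearMap.mkContinuous_norm_le _ (by positivity) _

/-- A contraction into `B(H)` is normal as soon as its coefficient functionals belong to the
predual. -/
lemma isNormalMap_of_coefFun_mem (M : VonNeumannAlgebra K) {H : Type*} [NormedAddCommGroup H]
    [InnerProductSpace ℂ H] [CompleteSpace H] (u : M.toStarSubalgebra →ₗ[ℂ] (H →L[ℂ] H))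
    (hu : ∀ x, ‖u x‖ ≤ ‖x‖) (h : ∀ ξ η, coefFun u hu ξ η ∈ predual (vnRep M)) :
    IsNormalMap M u := by
  refine continuous_iInf_rng.2 fun ξ => continuous_iInf_rng.2 fun η => continuous_induced_rng.2 ?_
  have hs : Summable fun n => coefFun u hu (ξ n) (η n) :=
    .of_norm_bounded (summable_norm_mul_norm ξ η) fun n => norm_coefFun_le u hu _ _
  have hx : ∀ x, HasSum (fun n => coefFun u hu (ξ n) (η n) x)
      ((∑' n, coefFun u hu (ξ n) (η n)) x) := fun x =>
    hs.hasSum.mapL (ContinuousLinearMap.apply ℂ ℂ x)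
  have hF : (∑' n, coefFun u hu (ξ n) (η n)) ∈ predual (vnRep M) :=
    mem_predual_of_hasSum _ (fun n => h (ξ n) (η n)) (summable_norm_mul_norm ξ η)
      (fun n => norm_coefFun_le u hu _ _) _ hx
  have := continuous_of_mem_predual M hF
  convert this using 1
  ext x
  exact (hx x).tsum_eq

end Normal

/-! ### Assembling the local factorizations -/

section Assembly

variable {K : Type u} [NormedAddCommGroup K] [InnerProductSpace ℂ K] [CompleteSpace K]

lemma exists_vecFun'_eq_smul {A : Type*} [NonUnitalCStarAlgebra A] (π : A →⋆ₙₐ[ℂ] (K →L[ℂ] K))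
    (ξ η : K) : ∃ ξ' η' : K, ‖ξ'‖ ≤ 1 ∧ ‖η'‖ ≤ 1 ∧
      vecFun' π ξ η = ((‖ξ‖ * ‖η‖ : ℝ) : ℂ) • vecFun' π ξ' η' := by
  have hn : ∀ x : K, ‖((‖x‖⁻¹ : ℝ) : ℂ) • x‖ ≤ 1 := by
    intro x
    rw [norm_smul, Complex.norm_real, norm_inv, norm_norm]
    exact inv_mul_le_one
  refine ⟨_, _, hn ξ, hn η, Subtype.ext ?_⟩
  rw [Submodule.coe_smul, coe_vecFun', coe_vecFun', vecFun_smul]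
  by_cases hξ : ξ = 0
  · ext x; simp [hξ]
  by_cases hη : η = 0
  · ext x; simp [hη]
  ext x
  have h1 : (‖ξ‖ : ℂ) ≠ 0 := by simpa using hξ
  have h2 : (‖η‖ : ℂ) ≠ 0 := by simpa using hη
  simp only [vecFun_apply, smul_apply, smul_eq_mul, Complex.real_smul, Complex.ofReal_mul,
    Complex.ofReal_inv]
  field_simp

/-- The block diagonal operator on a Hilbert sum. -/
def blockDiag {A I : Type*} [NonUnitalCStarAlgebra A] {N : I → ℕ} (α : ∀ i, A →ₗ[ℂ] MatAlg (N i))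
    (hα : ∀ i x, ‖α i x‖ ≤ ‖x‖) :
    A →ₗ[ℂ] (lp (fun i => EuclideanSpace ℂ (Fin (N i))) 2 →L[ℂ]
      lp (fun i => EuclideanSpace ℂ (Fin (N i))) 2) where
  toFun x := lp.mapCLM 2 (fun i => α i x) (norm_nonneg x) fun i => hα i x
  map_add' x y := by
    ext ξ i : 3
    simp
  map_smul' c x := by
    ext ξ i : 3
    simp

lemma blockDiag_apply {A I : Type*} [NonUnitalCStarAlgebra A] {N : I → ℕ}
    (α : ∀ i, A →ₗ[ℂ] MatAlg (N i)) (hα : ∀ i x, ‖α i x‖ ≤ ‖x‖) (x : A)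
    (ξ : lp (fun i => EuclideanSpace ℂ (Fin (N i))) 2) (i : I) :
    blockDiag α hα x ξ i = α i x (ξ i) := rfl

lemma norm_blockDiag_le {A I : Type*} [NonUnitalCStarAlgebra A] {N : I → ℕ}
    (α : ∀ i, A →ₗ[ℂ] MatAlg (N i)) (hα : ∀ i x, ‖α i x‖ ≤ ‖x‖) (x : A) :
    ‖blockDiag α hα x‖ ≤ ‖x‖ :=
  lp.norm_mapCLM_le 2 (fun i => α i x) (norm_nonneg x) fun i => hα i x

lemma coefFun_blockDiag_mem {A I : Type*} [NonUnitalCStarAlgebra A]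
    {π : A →⋆ₙₐ[ℂ] (K →L[ℂ] K)} {N : I → ℕ} (α : ∀ i, A →ₗ[ℂ] MatAlg (N i))
    (hα : ∀ i x, ‖α i x‖ ≤ ‖x‖) (hn : ∀ i, IsVecNormal π (α i))
    (ξ η : lp (fun i => EuclideanSpace ℂ (Fin (N i))) 2) :
    coefFun (blockDiag α hα) (norm_blockDiag_le α hα) ξ η ∈ predual π := by
  choose f hf using fun i => hn i (vecFun (idRep (EuclideanSpace ℂ (Fin (N i)))) (ξ i) (η i))
  refine mem_predual_of_hasSum (fun i => (f i : StrongDual ℂ A))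
    (fun i => vecSpan_le_predual π (f i).2) (summable_norm_mul_norm ξ η) (fun i => ?_) _
    fun x => ?_
  · refine ContinuousLinearMap.opNorm_le_bound _ (by positivity) fun x => ?_
    rw [← hf]
    refine (ContinuousLinearMap.le_opNorm _ _).trans ?_
    gcongr
    · exact norm_vecFun_le _ _ _
    · exact hα i x
  · have h := lp.hasSum_inner (𝕜 := ℂ) ξ (blockDiag α hα x η)
    simp only [← hf]
    exact h

/-- The inclusion of a summand in a Hilbert sum. -/
def summandIncl {I : Type*} [DecidableEq I] (E : I → Type*) [∀ i, NormedAddCommGroup (E i)]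
    [∀ i, InnerProductSpace ℂ (E i)] (i : I) : E i →ₗᵢ[ℂ] lp E 2 :=
  ⟨lp.lsingle (E := E) 2 i, fun x => lp.norm_single (E := E) (by norm_num) i x⟩

lemma inner_compress_summandIncl {I : Type*} [DecidableEq I] (E : I → Type*)
    [∀ i, NormedAddCommGroup (E i)] [∀ i, InnerProductSpace ℂ (E i)] [∀ i, CompleteSpace (E i)]
    (i : I) (y : lp E 2 →L[ℂ] lp E 2) (a b : E i) :
    inner ℂ a (compress (summandIncl E i).toContinuousLinearMap y b) =
      inner ℂ a (y (lp.single 2 i b) i) := by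
  rw [inner_compress]
  exact lp.inner_single_left i a (y (lp.single 2 i b))

lemma compress_blockDiag {A I : Type*} [DecidableEq I] [NonUnitalCStarAlgebra A] {N : I → ℕ}
    (α : ∀ i, A →ₗ[ℂ] MatAlg (N i)) (hα : ∀ i x, ‖α i x‖ ≤ ‖x‖) (i : I) (x : A) :
    compress (summandIncl (fun i => EuclideanSpace ℂ (Fin (N i))) i).toContinuousLinearMap
      (blockDiag α hα x) = α i x := by
  ext1 b
  refine ext_inner_left ℂ fun a => ?_
  refine (inner_compress_summandIncl (fun i => EuclideanSpace ℂ (Fin (N i))) i _ a b).trans ?_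
  rw [blockDiag_apply, lp.single_apply_self]

/-- Given maps `β i` satisfying more and more matricial constraints along an ultrafilter, the limits
of `β i f` composed with compressions define a complete contraction from `B(H)` to a weakly
closed algebra. -/
lemma IsWeaklyClosedRep.exists_limit_map {A : Type*} [NonUnitalCStarAlgebra A]
    {π : A →⋆ₙₐ[ℂ] (K →L[ℂ] K)} (hπ : IsWeaklyClosedRep π) {I : Type*} (U : Ultrafilter I)
    {H : Type*} [NormedAddCommGroup H] [InnerProductSpace ℂ H] [CompleteSpace H] {N : I → ℕ}
    (J : ∀ i, EuclideanSpace ℂ (Fin (N i)) →ₗᵢ[ℂ] H)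
    (β : ∀ i, vecSpan π →ₗ[ℂ] StrongDual ℂ (MatAlg (N i)))
    (hβ : ∀ c : Constr K, ∀ᶠ i in U, SatisfiesConstr π (β i) c) :
    ∃ v : (H →L[ℂ] H) →ₗ[ℂ] A,
      (∀ (n : ℕ) (a : CStarMatrix (Fin n) (Fin n) (H →L[ℂ] H))
        (ξ η : PiLp 2 (fun _ : Fin n => K)), ‖ξ‖ ≤ 1 → ‖η‖ ≤ 1 →
          ‖∑ p, ∑ q, inner ℂ (ξ p) (π (v (a p q)) (η q))‖ ≤ ‖a‖) ∧
      ∀ y (f : vecSpan π), Filter.Tendsto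
        (fun i => β i f (compress (J i).toContinuousLinearMap y)) U
        (𝓝 ((f : StrongDual ℂ A) (v y))) := by
  have hmat : ∀ (n : ℕ) (a : CStarMatrix (Fin n) (Fin n) (H →L[ℂ] H))
      (ξ η : PiLp 2 (fun _ : Fin n => K)), ‖ξ‖ ≤ 1 → ‖η‖ ≤ 1 → ∀ᶠ i in U,
        ‖∑ p, ∑ q, β i (vecFun' π (ξ p) (η q))
          (compress (J i).toContinuousLinearMap (a p q))‖ ≤ ‖a‖ := by
    intro n a ξ η hξ hη
    filter_upwards [hβ ⟨n, ξ, η⟩] with i hi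
    exact (hi hξ hη (a.map (compress (J i).toContinuousLinearMap))).trans
      (norm_map_compress_le (J i).norm_toContinuousLinearMap_le a)
  have hone : ∀ (y : H →L[ℂ] H) (ξ η : K), ‖ξ‖ ≤ 1 → ‖η‖ ≤ 1 → ∀ᶠ i in U,
      ‖β i (vecFun' π ξ η) (compress (J i).toContinuousLinearMap y)‖ ≤ ‖y‖ := by
    intro y ξ η hξ hη
    have hn : ∀ x : K, ‖x‖ ≤ 1 →
        ‖(WithLp.toLp 2 fun _ => x : PiLp 2 (fun _ : Fin 1 => K))‖ ≤ 1 := by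
      intro x hx
      rw [PiLp.norm_eq_of_L2]
      simpa using hx
    filter_upwards [hmat 1 (CStarMatrix.ofMatrix (Matrix.of fun _ _ => y))
      (WithLp.toLp 2 fun _ => ξ) (WithLp.toLp 2 fun _ => η) (hn ξ hξ) (hn η hη)] with i hi
    simp only [Finset.univ_unique, Finset.sum_singleton] at hi
    exact hi.trans (norm_oneByOne_le y)
  have hlim : ∀ y : H →L[ℂ] H, ∃ L : vecSpan π →ₗ[ℂ] ℂ, ∀ f, Filter.Tendsto
      (fun i => β i f (compress (J i).toContinuousLinearMap y)) U (𝓝 (L f)) := by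
    intro y
    refine exists_linear_limit U (fun i f => β i f (compress (J i).toContinuousLinearMap y))
      (fun f g => .of_forall fun i => by rw [map_add, add_apply])
      (fun c f => .of_forall fun i => by rw [map_smul, smul_apply]) fun f => ?_
    induction f using vecSpan_induction with
    | h1 ξ η =>
      obtain ⟨ξ', η', hξ, hη, h⟩ := exists_vecFun'_eq_smul π ξ η
      refine ⟨‖ξ‖ * ‖η‖ * ‖y‖, ?_⟩
      filter_upwards [hone y ξ' η' hξ hη] with i hi
      rw [h, map_smul, smul_apply, norm_smul, Complex.norm_real,
        Real.norm_of_nonneg (by positivity)]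
      gcongr
    | h0 => exact ⟨0, .of_forall fun i => by simp⟩
    | h2 f g hf hg =>
      obtain ⟨a, ha⟩ := hf
      obtain ⟨b, hb⟩ := hg
      refine ⟨a + b, ?_⟩
      filter_upwards [ha, hb] with i hi hi'
      rw [map_add, add_apply]
      exact (norm_add_le _ _).trans (add_le_add hi hi')
    | h3 c f hf =>
      obtain ⟨a, ha⟩ := hf
      refine ⟨‖c‖ * a, ?_⟩
      filter_upwards [ha] with i hi
      rw [map_smul, smul_apply, norm_smul]
      gcongr
  choose L hL using hlim
  let Ψ : (H →L[ℂ] H) →ₗ[ℂ] vecSpan π →ₗ[ℂ] ℂ :=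
    { toFun := L
      map_add' := fun y z => by
        ext f
        refine tendsto_nhds_unique (hL (y + z) f) ?_
        simpa using (hL y f).add (hL z f)
      map_smul' := fun c y => by
        ext f
        refine tendsto_nhds_unique (hL (c • y) f) ?_
        simpa using (hL y f).const_mul c }
  obtain ⟨v, hv⟩ := hπ.exists_linearMap Ψ (fun y => ‖y‖) fun y ξ η => by
    obtain ⟨ξ', η', hξ, hη, h⟩ := exists_vecFun'_eq_smul π ξ η
    rw [h, map_smul, norm_smul, Complex.norm_real, Real.norm_of_nonneg (by positivity), mul_comm,
      mul_assoc]
    gcongr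
    exact le_of_tendsto (hL y _).norm (hone y ξ' η' hξ hη)
  refine ⟨v, fun n a ξ η hξ hη => ?_, fun y f => by rw [hv]; exact hL y f⟩
  refine le_of_tendsto (Filter.Tendsto.norm ?_) (hmat n a ξ η hξ hη)
  refine tendsto_finsetSum _ fun p _ => tendsto_finsetSum _ fun q _ => ?_
  have h1 := hv (a p q) (vecFun' π (ξ p) (η q))
  rw [coe_vecFun', vecFun_apply] at h1
  rw [h1]
  exact hL _ _

end Assembly

end

end RemoteInj

theorem mainTheorem7 {K : Type u}
    [NormedAddCommGroup K] [InnerProductSpace ℂ K] [CompleteSpace K]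
    (M : VonNeumannAlgebra K) (hM : RemoteInj.IsQWEP.{u, v} M.toStarSubalgebra)
    {W : Type v} [NonUnitalCStarAlgebra W] [PartialOrder W] [StarOrderedRing W]
    (hW : RemoteInj.IsWEP W)
    (q : W →⋆ₙₐ[ℂ] M.toStarSubalgebra) (hq : Function.Surjective q)
    (hlift : RemoteInj.AdmitsContractiveLiftings q) :
    RemoteInj.IsRemotelyInjective M := by
  classical
  obtain ⟨H, _, _, _, w, T, hw, hT, hTw⟩ := hW.exists_factorization M q
  have hπ := RemoteInj.isWeaklyClosedRep_vnRep M
  have hs : ∀ Y : Submodule ℂ M.toStarSubalgebra, IsClosed (Y : Set M.toStarSubalgebra) →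
      TopologicalSpace.IsSeparable (Y : Set M.toStarSubalgebra) →
      ∃ s : Y →ₗ[ℂ] (H →L[ℂ] H), (∀ x, ‖s x‖ ≤ ‖x‖) ∧ ∀ x, T (s x) = x := by
    intro Y hYc hYs
    have : CompleteSpace Y := hYc.completeSpace_coe
    have : TopologicalSpace.SeparableSpace Y := hYs.separableSpace
    obtain ⟨û, hû, hqû⟩ := hlift Y Y.subtypeL (Submodule.norm_subtypeL_le Y)
    exact ⟨w ∘ₗ û.toLinearMap,
      fun x => (hw _).trans ((û.le_of_opNorm_le hû x).trans_eq (one_mul _)),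
      fun x => (hTw _).trans (hqû x)⟩
  -- an index consists of finitely many functionals, elements and constraints, and a precision
  let I := Finset (RemoteInj.vecSpan (RemoteInj.vnRep M)) × Finset M.toStarSubalgebra ×
    Finset (RemoteInj.Constr K) × ℕ
  choose N α β hβ hαn hα hαβ using fun i : I =>
    hπ.exists_local_factorization T hT hs i.1 i.2.1 i.2.2.1
      (ε := 1 / ((i.2.2.2 : ℝ) + 1)) (by positivity)
  let U : Ultrafilter I := Ultrafilter.of Filter.atTop
  have hU : ∀ i₀ : I, ∀ᶠ i in U, i₀ ≤ i := fun i₀ =>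
    Ultrafilter.of_le _ (Filter.eventually_ge_atTop i₀)
  let J := RemoteInj.summandIncl fun i => EuclideanSpace ℂ (Fin (N i))
  obtain ⟨v, hv, hvl⟩ := hπ.exists_limit_map U J β fun c => by
    filter_upwards [hU (∅, ∅, {c}, 0)] with i hi
    exact hβ i c (hi.2.2.1 (Finset.mem_singleton_self c))
  let u := RemoteInj.blockDiag α hα
  have hun : ∀ x, ‖u x‖ ≤ ‖x‖ := RemoteInj.norm_blockDiag_le α hα
  have hvu : ∀ x, v (u x) = x := by
    intro x
    refine hπ.ext fun f => tendsto_nhds_unique (hvl (u x) f) ?_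
    rw [tendsto_iff_norm_sub_tendsto_zero]
    have h0 : Filter.Tendsto (fun i : I => 1 / ((i.2.2.2 : ℝ) + 1)) U (𝓝 0) := by
      refine tendsto_one_div_add_atTop_nhds_zero_nat.comp (Filter.tendsto_atTop.2 fun n => ?_)
      filter_upwards [hU (∅, ∅, ∅, n)] with i hi
      exact hi.2.2.2
    refine squeeze_zero' (.of_forall fun i => norm_nonneg _) ?_ h0
    filter_upwards [hU ({f}, {x}, ∅, 0)] with i hi
    have h1 := hαβ i f (hi.1 (Finset.mem_singleton_self f)) x
      (hi.2.1 (Finset.mem_singleton_self x))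
    have h2 := RemoteInj.compress_blockDiag α hα i x
    exact (congrArg (fun y => ‖β i f y - (f : StrongDual ℂ M.toStarSubalgebra) x‖) h2).trans_le h1
  have hcc : RemoteInj.IsCompletelyContractive
      (M.toStarSubalgebra.subtype.toAlgHom.toLinearMap ∘ₗ v) := fun n a =>
    RemoteInj.norm_le_of_forall_inner (RemoteInj.idRep K) (fun _ _ h => h) _ (norm_nonneg a)
      fun ξ η hξ hη => hv n a ξ η hξ.le hη.le
  refine ⟨lp (fun i => EuclideanSpace ℂ (Fin (N i))) 2, inferInstance, inferInstance,
    inferInstance, ⟨u, fun x => le_antisymm (hun x) ?_⟩, v, ?_, hcc, hvu⟩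
  · have h1 := hcc.norm_le (u x)
    have h2 : ‖v (u x)‖ ≤ ‖u x‖ := h1
    rwa [hvu] at h2
  · exact RemoteInj.isNormalMap_of_coefFun_mem M u hun
      (RemoteInj.coefFun_blockDiag_mem α hα hαn)
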